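/- For a finite simple graph $G$ and $A\subseteq V(G)$ let $N(A)$ be the set of vertices outside $A$ that have at least one neighbour in $A$. For a real number $s$, a graph $G$ on $n$ vertices is called an $s$-expander if (i) $|N(A)|\ge s|A|$ for every $A\subseteq V(G)$ with $|A|\le \frac{4n\ln s}{s\ln n}$, and (ii) there is an edge of $G$ between any two disjoint sets $A,B\subseteq V(G)$ with $|A|,|B|\ge \frac{n\ln s}{3000\ln n}$. **Lemma.** For every $\alpha\in(0,1]$ there is an $n_0=n_0(\alpha)$ such that for every $n\ge n_0$ the following holds. Let $G$ be an $n^\alpha$-expander on $n$ vertices. Then for every matching $\mathcal M$ in $G$ with $|\mathcal M|\le \alpha^3 n/9200$ there is a Hamilton cycle $C$ in $G$ such that $$|E(\mathcal M)\setminus E(C)|\le\left\lfloor\frac{1036\,|\mathcal M|}{\alpha^3 n^{\alpha/2}}\right\rfloor .$$ -/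

import Mathlib

namespace ExpanderGraph

/-- The external neighborhood `N(A)`: all vertices outside `A` that have at least one
neighbor in `A`. -/
noncomputable def nbhd {V : Type*} [Fintype V] (G : SimpleGraph V) (A : Finset V) : Finset V :=
  open Classical in Finset.univ.filter (fun v => v ∉ A ∧ ∃ a ∈ A, G.Adj a v)

/-- The small expander property `S(s, g)` with expansion factor `s` and boundary `g`:
every vertex set `A` with `|A| ≤ g` satisfies `|N(A)| ≥ |A| s`. -/
def SmallExpander {V : Type*} [Fintype V] (G : SimpleGraph V) (s g : ℝ) : Prop :=
  ∀ A : Finset V, (A.card : ℝ) ≤ g → (A.card : ℝ) * s ≤ ((nbhd G A).card : ℝ)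

/-- The large expander property `L(l)` with frame `l`: there is an edge between any two
disjoint vertex sets of size at least `l`. -/
def LargeExpander {V : Type*} (G : SimpleGraph V) (l : ℝ) : Prop :=
  ∀ A B : Finset V, Disjoint A B → l ≤ (A.card : ℝ) → l ≤ (B.card : ℝ) →
    ∃ a ∈ A, ∃ b ∈ B, G.Adj a b

/-- An `(s, g, l)`-expander: a graph with the properties `S(s, g)` and `L(l)`. -/
def IsExpander {V : Type*} [Fintype V] (G : SimpleGraph V) (s g l : ℝ) : Prop :=
  SmallExpander G s g ∧ LargeExpander G l

/-- An `s`-expander on `n` vertices: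
an `(s, 4 n ln s / (s ln n), n ln s / (3000 ln n))`-expander. -/
def IsSExpander {V : Type*} [Fintype V] (G : SimpleGraph V) (s : ℝ) : Prop :=
  IsExpander G s
    (4 * (Fintype.card V : ℝ) * Real.log s / (s * Real.log (Fintype.card V : ℝ)))
    ((Fintype.card V : ℝ) * Real.log s / (3000 * Real.log (Fintype.card V : ℝ)))

end ExpanderGraph

/-! Call a vertex free if no edge of the current matching covers it. A Pósa rotation breaks only an
edge at its pivot, so rotations with free pivots preserve the matching. It remains to make small
sets expand into free vertices.

Deletion (`exists_deletion`): put each edge of the matching into `D` with probability n^(-α/2). If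
at least half of the lower bound n^α|X| on |N(X)| consists of free vertices, nothing is needed.
Otherwise at least n^α|X|/4 matching edges meet N(X), and deleting some of them frees enough
vertices. This fails for X with probability at most (4n)^(-|X|), which is summable over all nonempty
X, so one `D` with at most 4n^(-α/2)|M| edges serves every small X. Let `H` be the matching without
`D`.

Closing (`exists_isHamiltonianCycle_of_growth`): take a longest path containing every edge of `H`
that it meets. Each round of rotations multiplies the number of reachable heads by n^(α/4), so
O(1/α) rounds reach linearly many (`card_of_growth`). Cut the path into more blocks than the
rotations at both ends can break. Each block holds a core, a set of free pivots into which the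
vertices on or next to it expand (`exists_core`). Averaging gives ends adjacent to the cores of most
blocks. Splitting the path between two intact blocks, each half is rotated within its own core,
arbitrarily often and independently of the other, until both have many heads (`exists_card_heads`).
An edge between the two head sets closes a cycle. By connectivity a cycle missing a vertex would
open into a longer path, so it is Hamiltonian. -/

namespace ExpanderGraph

open List

/-! ### Consecutive elements of a list -/

section Consec

variable {V : Type*}

/-- `u` and `v` are consecutive in the list `l`, in either order. -/
def Consec (l : List V) (u v : V) : Prop := [u, v] <:+: l ∨ [v, u] <:+: l

theorem Consec.symm {l : List V} {u v : V} (h : Consec l u v) : Consec l v u := Or.symm h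

theorem Consec.mem_left {l : List V} {u v : V} (h : Consec l u v) : u ∈ l :=
  h.elim (fun h => h.subset (by simp)) (fun h => h.subset (by simp))

theorem Consec.mem_right {l : List V} {u v : V} (h : Consec l u v) : v ∈ l := h.symm.mem_left

theorem pair_infix_append {a b : List V} {u v : V} :
    [u, v] <:+: a ++ b ↔
      [u, v] <:+: a ∨ [u, v] <:+: b ∨ (a.getLast? = some u ∧ b.head? = some v) := by
  rw [infix_append_iff]
  constructor
  · rintro (h | h | ⟨s, t, hst, hs, ht⟩)
    · exact .inl h
    · exact .inr (.inl h)
    · rcases s with _ | ⟨x, _ | ⟨y, s⟩⟩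
      · simp only [nil_append] at hst
        subst hst
        exact .inr (.inl ht.isInfix)
      · simp only [cons_append, nil_append, cons.injEq] at hst
        obtain ⟨rfl, rfl⟩ := hst
        obtain ⟨a', rfl⟩ := hs
        obtain ⟨b', rfl⟩ := ht
        right; right; simp
      · simp only [cons_append, cons.injEq] at hst
        obtain ⟨rfl, rfl, hst⟩ := hst
        obtain ⟨rfl, rfl⟩ := append_eq_nil_iff.1 hst.symm
        exact .inl hs.isInfix
  · rintro (h | h | ⟨h1, h2⟩)
    · exact .inl h
    · exact .inr (.inl h)
    · right; right
      refine ⟨[u], [v], rfl, ?_, ?_⟩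
      · obtain ⟨a', rfl⟩ := getLast?_eq_some_iff.1 h1
        simp
      · obtain ⟨b', rfl⟩ := head?_eq_some_iff.1 h2
        simp

theorem consec_append {a b : List V} {u v : V} :
    Consec (a ++ b) u v ↔ Consec a u v ∨ Consec b u v ∨
      (a.getLast? = some u ∧ b.head? = some v) ∨ (a.getLast? = some v ∧ b.head? = some u) := by
  simp only [Consec, pair_infix_append]
  tauto

theorem not_consec_singleton {a u v : V} : ¬ Consec [a] u v := by
  intro h
  have := h.elim (·.length_le) (·.length_le)
  simp at this

theorem consec_cons {a : V} {l : List V} {u v : V} :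
    Consec (a :: l) u v ↔ Consec l u v ∨ (a = u ∧ l.head? = some v) ∨
      (a = v ∧ l.head? = some u) := by
  rw [← singleton_append, consec_append]
  simp [not_consec_singleton]

theorem consec_reverse {l : List V} {u v : V} : Consec l.reverse u v ↔ Consec l u v := by
  have h : ∀ u v : V, [u, v] <:+: l.reverse ↔ [v, u] <:+: l := fun u v => by
    rw [← reverse_infix]; simp
  simp only [Consec, h]
  tauto

theorem consec_split_iff {s t : List V} {x z : V} (h : (s ++ x :: t).Nodup) :
    Consec (s ++ x :: t) x z ↔ s.getLast? = some z ∨ t.head? = some z := by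
  have hx : x ∉ s ∧ x ∉ t := by
    have := nodup_middle.1 h
    rw [nodup_cons] at this
    simpa using this.1
  have h1 : ¬ Consec s x z := fun h => hx.1 h.mem_left
  have h2 : ¬ Consec t x z := fun h => hx.2 h.mem_left
  have h3 : s.getLast? ≠ some x := fun h => hx.1 (mem_of_getLast? h)
  have h4 : t.head? ≠ some x := fun h => hx.2 (mem_of_head? h)
  simp only [consec_append, consec_cons, h1, h2, h3, h4]
  simp
  tauto

/-- The interior of a segment sees the same neighbours in the segment and in the whole list. -/
theorem Consec.of_mem_interior {l I : List V} (hl : l.Nodup) (hI : I <:+: l) {x z : V}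
    (hx : x ∈ I.tail.dropLast) (h : Consec l x z) : Consec I x z := by
  obtain ⟨p, r, rfl⟩ := hI
  rcases I with _ | ⟨a, I⟩
  · simp at hx
  rcases I.eq_nil_or_concat with rfl | ⟨J, e, rfl⟩
  · simp at hx
  simp only [tail_cons, concat_eq_append, dropLast_concat] at hx
  obtain ⟨j, k, rfl⟩ := append_of_mem hx
  have e1 : p ++ a :: (j ++ x :: k).concat e ++ r = (p ++ a :: j) ++ x :: (k ++ e :: r) := by simp
  have e2 : a :: (j ++ x :: k).concat e = (a :: j) ++ x :: (k ++ [e]) := by simp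
  have hl2 : ((a :: j) ++ x :: (k ++ [e])).Nodup := by
    rw [← e2]; exact hl.sublist (infix_append p _ r).sublist
  rw [e1] at h hl
  rw [e2]
  rw [consec_split_iff hl] at h
  rw [consec_split_iff hl2]
  rcases h with h | h
  · left
    rw [getLast?_append_of_ne_nil _ (by simp)] at h
    exact h
  · right
    cases k <;> simpa using h

/-- `x` has at most one successor. -/
theorem pair_infix_right_unique {l : List V} (hl : l.Nodup) {z x y : V} (hx : [z, x] <:+: l)
    (hy : [z, y] <:+: l) : x = y := by
  obtain ⟨s, t, rfl⟩ := hx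
  have e : s ++ [z, x] ++ t = s ++ z :: (x :: t) := by simp
  rw [e] at hl hy
  have hz : z ∉ s ∧ z ∉ x :: t := by
    have := (nodup_cons.1 (nodup_middle.1 hl)).1
    simpa using this
  rw [pair_infix_append] at hy
  rcases hy with h | h | h
  · exact absurd (h.subset (by simp)) hz.1
  · rcases (pair_infix_append (a := [z]) (b := x :: t)).1 h with h | h | h
    · simpa using h.length_le
    · exact absurd (h.subset (by simp)) hz.2
    · simpa using h.2
  · exact absurd (mem_of_getLast? h.1) hz.1

theorem pair_infix_left_unique {l : List V} (hl : l.Nodup) {z x y : V} (hx : [x, z] <:+: l)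
    (hy : [y, z] <:+: l) : x = y := by
  refine pair_infix_right_unique (l := l.reverse) (z := z) (nodup_reverse.2 hl) ?_ ?_
  · rw [← reverse_infix]; simpa using hx
  · rw [← reverse_infix]; simpa using hy

open Classical in
/-- A set `S` together with its neighbours in a duplicate-free list has size at most `3|S|`. -/
theorem card_consec_le [Fintype V] {l : List V} (hl : l.Nodup) (S : Finset V) :
    (Finset.univ.filter (fun x => x ∈ S ∨ ∃ z ∈ S, Consec l x z)).card ≤ 3 * S.card := by
  have hsub : Finset.univ.filter (fun x => x ∈ S ∨ ∃ z ∈ S, Consec l x z) ⊆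
      S ∪ Finset.univ.filter (fun x => ∃ z ∈ S, [x, z] <:+: l) ∪
        Finset.univ.filter (fun x => ∃ z ∈ S, [z, x] <:+: l) := by
    intro x hx
    rw [Finset.mem_filter] at hx
    rw [Finset.mem_union, Finset.mem_union, Finset.mem_filter, Finset.mem_filter]
    simp only [Finset.mem_univ, true_and, Consec] at hx ⊢
    rcases hx with (h | ⟨z, hz, h | h⟩)
    · exact .inl (.inl h)
    · exact .inl (.inr ⟨z, hz, h⟩)
    · exact .inr ⟨z, hz, h⟩
  have h1 : (Finset.univ.filter (fun x => ∃ z ∈ S, [x, z] <:+: l)).card ≤ S.card := by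
    refine Finset.card_le_card_of_forall_subsingleton (fun x z => [x, z] <:+: l) ?_ ?_
    · intro x hx
      simpa using hx
    · intro z _ x hx y hy
      exact pair_infix_left_unique hl hx.2 hy.2
  have h2 : (Finset.univ.filter (fun x => ∃ z ∈ S, [z, x] <:+: l)).card ≤ S.card := by
    refine Finset.card_le_card_of_forall_subsingleton (fun x z => [z, x] <:+: l) ?_ ?_
    · intro x hx
      simpa using hx
    · intro z _ x hx y hy
      exact pair_infix_right_unique hl hx.2 hy.2
  have := Finset.card_le_card hsub
  have := Finset.card_union_le (S ∪ Finset.univ.filter (fun x => ∃ z ∈ S, [x, z] <:+: l))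
    (Finset.univ.filter (fun x => ∃ z ∈ S, [z, x] <:+: l))
  have := Finset.card_union_le S (Finset.univ.filter (fun x => ∃ z ∈ S, [x, z] <:+: l))
  omega

theorem infix_of_disjoint_left {A B J : List V} (h : J <:+: A ++ B) (hJ : J ≠ [])
    (hd : ∀ x ∈ J, x ∉ A) : J <:+: B := by
  rcases infix_append_iff.1 h with h | h | ⟨s, t, rfl, hs, ht⟩
  · obtain ⟨x, hx⟩ := exists_mem_of_ne_nil J hJ
    exact absurd (h.subset hx) (hd x hx)
  · exact h
  · rcases s with _ | ⟨x, s⟩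
    · simpa using ht.isInfix
    · exact absurd (hs.subset (by simp)) (hd x (by simp))

theorem infix_split_of_notMem {p r J : List V} {x : V} (h : J <:+: p ++ x :: r) (hx : x ∉ J) :
    J <:+: p ∨ J <:+: r := by
  rcases infix_append_iff.1 h with h | h | ⟨s, t, rfl, hs, ht⟩
  · exact .inl h
  · by_cases hJ : J = []
    · subst hJ; left; exact nil_infix
    · right
      exact infix_of_disjoint_left (A := [x]) h hJ (by rintro y hy; simp; rintro rfl; exact hx hy)
  · rcases t with _ | ⟨y, t⟩
    · left; simpa using hs.isInfix
    · obtain ⟨r', hr⟩ := ht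
      simp only [cons_append, cons.injEq] at hr
      exact absurd (by simp [hr.1]) hx

end Consec

/-! ### Pósa rotations -/

section Rotations

variable {V : Type*} {G : SimpleGraph V} {Q : Set V}

/-- `l'` arises from the path `l` by a rotation of its head with pivot in `Q`. -/
def Rot (G : SimpleGraph V) (Q : Set V) (l l' : List V) : Prop :=
  ∃ a p x r, l = a :: (p ++ x :: r) ∧ l' = p.reverse ++ a :: x :: r ∧ G.Adj a x ∧ x ∈ Q

/-- `l'` arises from `l` by at most `t` rotations with pivots in `Q`. -/
def RotN (G : SimpleGraph V) (Q : Set V) : ℕ → List V → List V → Prop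
  | 0, l, l' => l' = l
  | t + 1, l, l'' => ∃ l', RotN G Q t l l' ∧ (l'' = l' ∨ Rot G Q l' l'')

theorem Rot.perm {l l' : List V} (h : Rot G Q l l') : l'.Perm l := by
  obtain ⟨a, p, x, r, rfl, rfl, -, -⟩ := h
  refine perm_middle.trans (Perm.cons a ?_)
  exact (reverse_perm p).append_right _

theorem Rot.chain {l l' : List V} (h : Rot G Q l l') (hl : l.IsChain G.Adj) :
    l'.IsChain G.Adj := by
  obtain ⟨a, p, x, r, rfl, rfl, hax, -⟩ := h
  have e : a :: (p ++ x :: r) = (a :: p) ++ x :: r := rfl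
  have e' : p.reverse ++ a :: x :: r = (a :: p).reverse ++ x :: r := by simp
  rw [e] at hl
  rw [e', isChain_append]
  refine ⟨isChain_reverse.2 (hl.left_of_append.imp fun _ _ h => h.symm), hl.right_of_append, ?_⟩
  intro y hy z hz
  simp at hy hz
  subst hy; subst hz
  exact hax

theorem Rot.getLast? {l l' : List V} (h : Rot G Q l l') : l'.getLast? = l.getLast? := by
  obtain ⟨a, p, x, r, rfl, rfl, hax, -⟩ := h
  have e : a :: (p ++ x :: r) = (a :: p) ++ x :: r := rfl
  have e' : p.reverse ++ a :: x :: r = (a :: p).reverse ++ x :: r := by simp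
  rw [e, e', getLast?_append_of_ne_nil _ (by simp), getLast?_append_of_ne_nil _ (by simp)]

/-- The only pair that a rotation separates contains the pivot, which lies in `Q`. -/
theorem Rot.consec {l l' : List V} (h : Rot G Q l l') {u v : V} (huv : Consec l u v)
    (hu : u ∉ Q) (hv : v ∉ Q) : Consec l' u v := by
  obtain ⟨a, p, x, r, rfl, rfl, hax, hx⟩ := h
  have e : a :: (p ++ x :: r) = (a :: p) ++ x :: r := rfl
  have e' : p.reverse ++ a :: x :: r = (a :: p).reverse ++ x :: r := by simp
  rw [e, consec_append] at huv
  rw [e', consec_append, consec_reverse]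
  rcases huv with h | h | ⟨-, h⟩ | ⟨-, h⟩
  · exact .inl h
  · exact .inr (.inl h)
  · simp at h; subst h; exact absurd hx hv
  · simp at h; subst h; exact absurd hx hu

/-- Structure of a rotation: the new head `z` was consecutive to the pivot `x`, and the only new
consecutive pair consists of the old head and the pivot. -/
theorem Rot.exists_head {l l' : List V} (h : Rot G Q l l') :
    ∃ a x z, l.head? = some a ∧ l'.head? = some z ∧ x ∈ Q ∧ Consec l z x ∧
      ∀ u v, Consec l' u v → Consec l u v ∨ (u = a ∧ v = x) ∨ (u = x ∧ v = a) := by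
  obtain ⟨a, p, x, r, rfl, rfl, hax, hx⟩ := h
  have e : a :: (p ++ x :: r) = (a :: p) ++ x :: r := rfl
  have e' : p.reverse ++ a :: x :: r = (a :: p).reverse ++ x :: r := by simp
  -- Taking the last entry of `a :: p` covers `p = []`, where the rotation is trivial and the new
  -- head is `a` again.
  refine ⟨a, x, (a :: p).getLast (by simp), by simp, ?_, hx, ?_, ?_⟩
  · rw [e', head?_append_of_ne_nil _ (by simp), head?_reverse, getLast?_eq_some_getLast]
  · rw [e, consec_append]
    right; right; left
    exact ⟨getLast?_eq_some_getLast _, rfl⟩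
  · intro u v huv
    rw [e', consec_append, consec_reverse] at huv
    rw [e, consec_append]
    rcases huv with h | h | ⟨h, h'⟩ | ⟨h, h'⟩
    · exact .inl (.inl h)
    · exact .inl (.inr (.inl h))
    · simp at h h'
      exact .inr (.inl ⟨h.symm, h'.symm⟩)
    · simp at h h'
      exact .inr (.inr ⟨h'.symm, h.symm⟩)

theorem exists_rot {l : List V} {a x : V} (ha : l.head? = some a) (hax : G.Adj a x)
    (hx : x ∈ Q) (hxl : x ∈ l) : ∃ l', Rot G Q l l' := by
  obtain ⟨r, rfl⟩ := head?_eq_some_iff.1 ha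
  have : x ∈ r := by
    rcases mem_cons.1 hxl with rfl | h
    · exact absurd hax (G.loopless.irrefl _)
    · exact h
  obtain ⟨s, t, rfl⟩ := append_of_mem this
  exact ⟨_, a, s, x, t, rfl, rfl, hax, hx⟩

/-- The segment `I` occurs, possibly reversed, as a block of `l`. -/
def Unbroken (I l : List V) : Prop := I <:+: l ∨ I.reverse <:+: l

theorem Unbroken.reverse {I l : List V} (h : Unbroken I l) : Unbroken I l.reverse := by
  rcases h with h | h
  · right; exact reverse_infix.2 h
  · left; rw [← reverse_infix]; simpa using h

theorem infix_rot {p r J : List V} {x : V} (h : J <:+: p ++ x :: r) (hx : x ∉ J) :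
    Unbroken J (p.reverse ++ x :: r) := by
  rcases infix_split_of_notMem h hx with h | h
  · right
    exact infix_append_of_infix_left (reverse_infix.2 h)
  · left
    exact infix_append_of_infix_right (h.trans (suffix_cons x r).isInfix)

theorem Unbroken.of_reverse {I l : List V} (h : Unbroken I.reverse l) : Unbroken I l := by
  rcases h with h | h
  · exact .inr h
  · left; simpa using h

/-- The path is cut immediately before the pivot, so the pivot is a witness that works for all
blocks at once. -/
theorem Rot.unbroken {l l' : List V} (h : Rot G Q l l') :
    ∃ x, ∀ I, x ∉ I → Unbroken I l → Unbroken I l' := by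
  obtain ⟨a, p, x, r, rfl, rfl, hax, hx⟩ := h
  have e : a :: (p ++ x :: r) = (a :: p) ++ x :: r := rfl
  have e' : p.reverse ++ a :: x :: r = (a :: p).reverse ++ x :: r := by simp
  refine ⟨x, fun I hI h => ?_⟩
  rw [e] at h
  rw [e']
  rcases h with h | h
  · exact infix_rot h hI
  · exact (infix_rot h (by simpa using hI)).of_reverse

theorem RotN.perm {t : ℕ} {l l' : List V} (h : RotN G Q t l l') : l'.Perm l := by
  induction t generalizing l' with
  | zero => obtain rfl := h; exact .refl _
  | succ t ih =>
    obtain ⟨m, hm, rfl | h⟩ := h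
    · exact ih hm
    · exact h.perm.trans (ih hm)

theorem RotN.chain {t : ℕ} {l l' : List V} (h : RotN G Q t l l') (hl : l.IsChain G.Adj) :
    l'.IsChain G.Adj := by
  induction t generalizing l' with
  | zero => obtain rfl := h; exact hl
  | succ t ih =>
    obtain ⟨m, hm, rfl | h⟩ := h
    · exact ih hm
    · exact h.chain (ih hm)

theorem RotN.getLast? {t : ℕ} {l l' : List V} (h : RotN G Q t l l') :
    l'.getLast? = l.getLast? := by
  induction t generalizing l' with
  | zero => obtain rfl := h; rfl
  | succ t ih =>
    obtain ⟨m, hm, rfl | h⟩ := h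
    · exact ih hm
    · exact h.getLast?.trans (ih hm)

theorem RotN.consec {t : ℕ} {l l' : List V} (h : RotN G Q t l l') {u v : V}
    (huv : Consec l u v) (hu : u ∉ Q) (hv : v ∉ Q) : Consec l' u v := by
  induction t generalizing l' with
  | zero => obtain rfl := h; exact huv
  | succ t ih =>
    obtain ⟨m, hm, rfl | h⟩ := h
    · exact ih hm
    · exact h.consec (ih hm) hu hv

open Classical in
-- `Z` collects the pivots. Among disjoint blocks, at most `t` can therefore be destroyed.
theorem RotN.unbroken {t : ℕ} {l l' : List V} (h : RotN G Q t l l') :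
    ∃ Z : Finset V, Z.card ≤ t ∧ ∀ I, (∀ x ∈ Z, x ∉ I) → Unbroken I l → Unbroken I l' := by
  induction t generalizing l' with
  | zero => obtain rfl := h; exact ⟨∅, by simp, fun _ _ h => h⟩
  | succ t ih =>
    obtain ⟨m, hm, rfl | h⟩ := h
    · obtain ⟨Z, hZ, h⟩ := ih hm
      exact ⟨Z, by omega, h⟩
    · obtain ⟨Z, hZ, hI⟩ := ih hm
      obtain ⟨x, hx⟩ := h.unbroken
      refine ⟨insert x Z, (Finset.card_insert_le _ _).trans (by omega), fun I hd h => ?_⟩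
      exact hx I (hd x (by simp)) (hI I (fun y hy => hd y (by simp [hy])) h)

theorem RotN.nodup {t : ℕ} {l l' : List V} (h : RotN G Q t l l') (hl : l.Nodup) : l'.Nodup :=
  h.perm.nodup_iff.2 hl

variable [Fintype V]

open Classical in
/-- The set of heads of the paths obtained from `l` by at most `t` rotations. -/
noncomputable def heads (G : SimpleGraph V) (Q : Set V) (l : List V) (t : ℕ) : Finset V :=
  Finset.univ.filter fun v => ∃ l', RotN G Q t l l' ∧ l'.head? = some v

theorem mem_heads {l : List V} {t : ℕ} {v : V} :
    v ∈ heads G Q l t ↔ ∃ l', RotN G Q t l l' ∧ l'.head? = some v := by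
  simp [heads]

theorem heads_mono {l : List V} {t : ℕ} : heads G Q l t ⊆ heads G Q l (t + 1) := by
  intro v
  simp only [mem_heads]
  rintro ⟨l', h, hv⟩
  exact ⟨l', ⟨l', h, .inl rfl⟩, hv⟩

/-- Every vertex either is near the endpoints reached so far or has kept its neighbours. -/
theorem RotN.near_or {t : ℕ} {l l' : List V} (h : RotN G Q t l l') (x : V) :
    (x ∈ heads G Q l t ∨ ∃ z ∈ heads G Q l t, Consec l x z) ∨
      ∀ z, Consec l' x z → Consec l x z := by
  induction t generalizing l' with
  | zero => obtain rfl := h; exact .inr fun _ h => h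
  | succ t ih =>
    obtain ⟨m, hm, h⟩ := h
    rcases ih hm with (h1 | ⟨z, hz, h1⟩) | h1
    · exact .inl (.inl (heads_mono h1))
    · exact .inl (.inr ⟨z, heads_mono hz, h1⟩)
    rcases h with rfl | h
    · exact .inr h1
    obtain ⟨a, y, z, ha, hz, hy, hzy, huv⟩ := h.exists_head
    -- Only the old head and the pivot gain a neighbour. The old head is in `heads`, and the pivot
    -- was next to the new head, already in `l` by `h1`.
    by_cases hxa : x = a
    · subst hxa
      exact .inl (.inl (heads_mono (mem_heads.2 ⟨m, hm, ha⟩)))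
    by_cases hxy : x = y
    · subst hxy
      exact .inl (.inr ⟨z, mem_heads.2 ⟨l', ⟨m, hm, .inr h⟩, hz⟩, h1 z hzy.symm⟩)
    refine .inr fun w hw => h1 w ?_
    rcases huv _ _ hw with h | h | h
    · exact h
    · exact absurd h.1 hxa
    · exact absurd h.1 hxy

/-- Pósa's lemma: pivots adjacent to an endpoint are near the endpoints of the next round. -/
theorem near_heads {l : List V} {t : ℕ} {v x : V} (hv : v ∈ heads G Q l t) (hvx : G.Adj v x)
    (hx : x ∈ Q) (hxl : x ∈ l) :
    x ∈ heads G Q l (t + 1) ∨ ∃ z ∈ heads G Q l (t + 1), Consec l x z := by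
  obtain ⟨m, hm, hmv⟩ := mem_heads.1 hv
  rcases m with _ | ⟨a, m⟩
  · simp at hmv
  have hxm : x ∈ a :: m := hm.perm.mem_iff.2 hxl
  simp only [head?_cons, Option.some.injEq] at hmv
  subst hmv
  have : x ∈ m := by
    rcases mem_cons.1 hxm with rfl | h
    · exact absurd hvx (G.loopless.irrefl _)
    · exact h
  obtain ⟨p, r, rfl⟩ := append_of_mem this
  -- The singleton pivot set forces the pivot returned by `exists_head` to be `x`.
  have hrot : Rot G {x} (a :: (p ++ x :: r)) (p.reverse ++ a :: x :: r) :=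
    ⟨a, p, x, r, rfl, rfl, hvx, rfl⟩
  have hrot' : Rot G Q (a :: (p ++ x :: r)) (p.reverse ++ a :: x :: r) :=
    ⟨a, p, x, r, rfl, rfl, hvx, hx⟩
  obtain ⟨b, y, z, hb, hz, hy, hzy, -⟩ := hrot.exists_head
  obtain rfl : y = x := hy
  rcases hm.near_or y with (h1 | ⟨z, hz, h1⟩) | h1
  · exact .inl (heads_mono h1)
  · exact .inr ⟨z, heads_mono hz, h1⟩
  · exact .inr ⟨z, mem_heads.2 ⟨_, ⟨_, hm, .inr hrot'⟩, hz⟩, h1 z hzy.symm⟩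

open Classical in
theorem card_near_heads_le {l : List V} (hl : l.Nodup) (t : ℕ) {N : Finset V}
    (hN : ∀ x ∈ N, x ∈ Q ∧ x ∈ l ∧ ∃ v ∈ heads G Q l t, G.Adj v x) :
    N.card ≤ 3 * (heads G Q l (t + 1)).card := by
  refine le_trans (Finset.card_le_card ?_) (card_consec_le hl (heads G Q l (t + 1)))
  intro x hx
  obtain ⟨h1, h2, v, hv, hvx⟩ := hN x hx
  simpa using near_heads hv hvx h1 h2

end Rotations

/-! ### Expanding cores inside a segment -/

section Core

variable {V : Type*} {G : SimpleGraph V}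

open Classical in
/-- Inside every large set `Q₀` there is a large subset `Q` into which all small sets of vertices
on or next to `Q` expand. -/
theorem exists_core [Fintype V] {lam : ℕ} (hG : ∀ A B : Finset V, lam ≤ A.card → lam ≤ B.card →
    ∃ a ∈ A, ∃ b ∈ B, G.Adj a b) {I : List V} (hI : I.Nodup) {Q₀ : Finset V}
    (hQ₀ : 21 * lam ≤ Q₀.card) :
    ∃ Q ⊆ Q₀, lam ≤ Q.card ∧ ∀ Y : Finset V, Y.Nonempty → Y.card ≤ lam →
      (∀ y ∈ Y, y ∈ Q ∨ ∃ x ∈ Q, Consec I x y) →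
        7 * Y.card ≤ (Q.filter fun x => ∃ y ∈ Y, G.Adj y x).card := by
  let cl : Finset V → Finset V := fun X =>
    Finset.univ.filter (fun x => x ∈ X ∨ ∃ z ∈ X, Consec I x z)
  have hcl : ∀ X, (cl X).card ≤ 3 * X.card := card_consec_le hI
  let N : Finset V → Finset V → Finset V := fun X R => R.filter fun x => ∃ y ∈ X, G.Adj y x
  -- A largest non-expanding set `X` is discarded together with its neighbours along `I`; what is
  -- left of `Q₀` is the core.
  let F : Finset (Finset V) := Finset.univ.filter fun X =>
    X.card ≤ 2 * lam ∧ (N X (Q₀ \ cl X)).card ≤ 7 * X.card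
  have hF : F.Nonempty := ⟨∅, by simp [F, N]⟩
  obtain ⟨X, hXF, hmax⟩ := F.exists_max_image Finset.card hF
  simp only [F, Finset.mem_filter, Finset.mem_univ, true_and] at hXF hmax
  have hsd : ∀ X : Finset V, Q₀.card ≤ (Q₀ \ cl X).card + 3 * X.card := fun X => by
    have := Finset.le_card_sdiff (cl X) Q₀
    have := hcl X
    omega
  -- If `lam ≤ |X|`, fewer than `lam` vertices of `Q₀ \ cl X` miss N(X), so `|Q₀| < lam + 7|X| +
  -- 3|X| ≤ 21 lam`.
  have hXlam : X.card < lam := by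
    by_contra hcon
    push Not at hcon
    have h1 : ((Q₀ \ cl X) \ N X (Q₀ \ cl X)).card < lam := by
      by_contra h
      push Not at h
      obtain ⟨a, ha, b, hb, hab⟩ := hG _ _ hcon h
      rw [Finset.mem_sdiff] at hb
      exact hb.2 (Finset.mem_filter.2 ⟨hb.1, a, ha, hab⟩)
    have h2 := Finset.le_card_sdiff (N X (Q₀ \ cl X)) (Q₀ \ cl X)
    have h3 := hsd X
    omega
  refine ⟨Q₀ \ cl X, Finset.sdiff_subset, ?_, ?_⟩
  · have := hsd X
    omega
  · intro Y hY hYlam hYQ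
    by_contra hcon
    push Not at hcon
    -- The core avoids `X` and the list neighbours of `X`, so no vertex on or next to the core is in
    -- `X`. A non-expanding `Y` would then enlarge `X`, against maximality.
    have hdisj : Disjoint X Y := by
      rw [Finset.disjoint_left]
      intro y hyX hyY
      rcases hYQ y hyY with h | ⟨x, hx, h⟩
      · exact (Finset.mem_sdiff.1 h).2 (Finset.mem_filter.2 ⟨Finset.mem_univ _, .inl hyX⟩)
      · exact (Finset.mem_sdiff.1 hx).2
          (Finset.mem_filter.2 ⟨Finset.mem_univ _, .inr ⟨y, hyX, h⟩⟩)
    have hcard := Finset.card_union_of_disjoint hdisj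
    have hpos := hY.card_pos
    have hsub : N (X ∪ Y) (Q₀ \ cl (X ∪ Y)) ⊆ N X (Q₀ \ cl X) ∪ N Y (Q₀ \ cl X) := by
      intro x hx
      obtain ⟨hx, y, hy, hyx⟩ := Finset.mem_filter.1 hx
      have hx' : x ∈ Q₀ \ cl X := by
        rw [Finset.mem_sdiff] at hx ⊢
        refine ⟨hx.1, fun h => hx.2 ?_⟩
        obtain ⟨-, h⟩ := Finset.mem_filter.1 h
        refine Finset.mem_filter.2 ⟨Finset.mem_univ _, ?_⟩
        exact h.imp (fun h => Finset.mem_union_left _ h)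
          (fun ⟨z, hz, h⟩ => ⟨z, Finset.mem_union_left _ hz, h⟩)
      rcases Finset.mem_union.1 hy with h | h
      · exact Finset.mem_union_left _ (Finset.mem_filter.2 ⟨hx', y, h, hyx⟩)
      · exact Finset.mem_union_right _ (Finset.mem_filter.2 ⟨hx', y, h, hyx⟩)
    have h1 := (Finset.card_le_card hsub).trans (Finset.card_union_le _ _)
    have h2 : (N Y (Q₀ \ cl X)).card < 7 * Y.card := hcon
    have := hmax (X ∪ Y) ⟨by omega, by omega⟩
    omega

/-- All heads of rotations with pivots in `Q` lie on or next to `Q`. -/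
theorem RotN.head_near {l I : List V} {Q : Set V} {a : V} (ha : l.head? = some a)
    (hQ : ∀ x ∈ Q, ∀ z, Consec l x z → Consec I x z) {t : ℕ} {l' : List V}
    (h : RotN G Q t l l') :
    (∀ z, l'.head? = some z → z = a ∨ z ∈ Q ∨ ∃ x ∈ Q, Consec I x z) ∧
      ∀ u v, Consec l' u v → Consec l u v ∨
        ((u = a ∨ u ∈ Q ∨ ∃ x ∈ Q, Consec I x u) ∧ (v = a ∨ v ∈ Q ∨ ∃ x ∈ Q, Consec I x v)) := by
  induction t generalizing l' with
  | zero =>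
    obtain rfl := h
    exact ⟨fun z hz => .inl (by simpa [ha] using hz.symm), fun u v h => .inl h⟩
  | succ t ih =>
    obtain ⟨m, hm, rfl | h⟩ := h
    · exact ih hm
    obtain ⟨ih1, ih2⟩ := ih hm
    obtain ⟨b, x, z, hb, hz, hx, hzx, huv⟩ := h.exists_head
    refine ⟨fun w hw => ?_, fun u v h => ?_⟩
    · obtain rfl : z = w := by rw [hz] at hw; simpa using hw
      rcases ih2 _ _ hzx with h | h
      · exact .inr (.inr ⟨x, hx, hQ x hx z h.symm⟩)
      · exact h.1
    · rcases huv u v h with h | ⟨rfl, rfl⟩ | ⟨rfl, rfl⟩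
      · exact ih2 u v h
      · exact .inr ⟨ih1 _ hb, .inr (.inl hx)⟩
      · exact .inr ⟨.inr (.inl hx), ih1 _ hb⟩

open Classical in
/-- Rotations with pivots in an expanding core reach many heads. -/
theorem exists_card_heads [Fintype V] {lam : ℕ} {l I : List V} (hl : l.Nodup) {Q : Finset V}
    (hQI : ∀ x ∈ Q, ∀ z, Consec l x z → Consec I x z) (hQl : ∀ x ∈ Q, x ∈ l)
    (hexp : ∀ Y : Finset V, Y.Nonempty → Y.card ≤ lam →
      (∀ y ∈ Y, y ∈ Q ∨ ∃ x ∈ Q, Consec I x y) →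
        7 * Y.card ≤ (Q.filter fun x => ∃ y ∈ Y, G.Adj y x).card)
    {a x : V} (ha : l.head? = some a) (hx : x ∈ Q) (hax : G.Adj a x) :
    ∃ t, lam ≤ (heads G (Q : Set V) l t).card := by
  by_contra! hcon
  -- If the number of heads never reached `lam`, it would have to stagnate at some round.
  have hex : ∃ t, (heads G (Q : Set V) l (t + 2)).card ≤ (heads G (Q : Set V) l (t + 1)).card := by
    by_contra! h
    have : ∀ t, t ≤ (heads G (Q : Set V) l (t + 1)).card := by
      intro t
      induction t with
      | zero => simp
      | succ t ih =>
        have h' : _ < (heads G (Q : Set V) l (t + 1 + 1)).card := h t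
        omega
    have := this lam
    have := hcon (lam + 1)
    omega
  obtain ⟨t, ht⟩ := hex
  set S := heads G (Q : Set V) l (t + 1) with hS
  -- Of all heads only the initial one, `a`, may be far from `Q`.
  let Y := S.filter fun y => y ∈ Q ∨ ∃ x ∈ Q, Consec I x y
  have hSY : S ⊆ insert a Y := by
    intro z hz
    obtain ⟨l', hl', hz'⟩ := mem_heads.1 hz
    rcases (hl'.head_near ha hQI).1 z hz' with h | h
    · simp [h]
    · exact Finset.mem_insert_of_mem (Finset.mem_filter.2 ⟨hz, h⟩)
  have hYne : Y.Nonempty := by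
    obtain ⟨l', h⟩ := exists_rot ha hax (Q := {x}) rfl (hQl x hx)
    obtain ⟨b, y, z, hb, hz, hy, hzy, -⟩ := h.exists_head
    obtain rfl : y = x := hy
    have h' : Rot G (Q : Set V) l l' := by
      obtain ⟨a, p, x, r, h1, h2, h3, h4⟩ := h
      obtain rfl : x = y := h4
      exact ⟨a, p, x, r, h1, h2, h3, hx⟩
    refine ⟨z, Finset.mem_filter.2 ⟨?_, .inr ⟨y, hx, hQI y hx z hzy.symm⟩⟩⟩
    have : ∀ t, z ∈ heads G (Q : Set V) l (t + 1) := by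
      intro t
      induction t with
      | zero => exact mem_heads.2 ⟨l', ⟨l, rfl, .inr h'⟩, hz⟩
      | succ t ih => exact heads_mono ih
    exact this t
  have hYS : Y.card ≤ S.card := Finset.card_filter_le _ _
  have h1 := hexp Y hYne (hYS.trans (hcon _).le) (fun y hy => (Finset.mem_filter.1 hy).2)
  have h2 := card_near_heads_le (G := G) (Q := (Q : Set V)) hl (t + 1)
    (N := Q.filter fun x => ∃ y ∈ Y, G.Adj y x) (by
      intro x hx
      obtain ⟨hx, y, hy, hyx⟩ := Finset.mem_filter.1 hx
      exact ⟨hx, hQl x hx, y, (Finset.mem_filter.1 hy).1, hyx⟩)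
  have h3 := (Finset.card_le_card hSY).trans (Finset.card_insert_le a Y)
  have h4 := hYne.card_pos
  have h5 : (heads G (Q : Set V) l (t + 1 + 1)).card ≤ S.card := ht
  -- Stagnation gives `7|Y| ≤ 3|S| ≤ 3(|Y| + 1) ≤ 6|Y|` with `Y` nonempty; this is why the core must
  -- expand by 7.
  omega

end Core

/-! ### Paths and cycles respecting a matching -/

section Compat

variable {V : Type*} {G H : SimpleGraph V}

/-- Every edge of `H` meeting the path `l` is an edge of `l`. -/
def Compat (H : SimpleGraph V) (l : List V) : Prop :=
  ∀ u v, H.Adj u v → u ∈ l → Consec l u v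

/-- `l` is a path of `G` that contains every edge of `H` it meets. -/
structure CompatPath (G H : SimpleGraph V) (l : List V) : Prop where
  nodup : l.Nodup
  chain : l.IsChain G.Adj
  compat : Compat H l

theorem CompatPath.reverse {l : List V} (h : CompatPath G H l) : CompatPath G H l.reverse where
  nodup := nodup_reverse.2 h.nodup
  chain := isChain_reverse.2 (h.chain.imp fun _ _ h => h.symm)
  compat u v huv hu := consec_reverse.2 (h.compat u v huv (by simpa using hu))

theorem CompatPath.rotN {l l' : List V} {Q : Set V} {t : ℕ} (h : CompatPath G H l)
    (hQ : ∀ x ∈ Q, ∀ y, ¬ H.Adj x y) (hr : RotN G Q t l l') : CompatPath G H l' where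
  nodup := hr.nodup h.nodup
  chain := hr.chain h.chain
  compat u v huv hu := hr.consec (h.compat u v huv (hr.perm.mem_iff.1 hu))
    (fun hu => hQ u hu v huv) (fun hv => hQ v hv u huv.symm)

/-- If `u` has a partner `w` in `H`, both are prepended, so that the edge `uw` is on the new path.
Compatibility of `l` keeps `w` off `l`. -/
theorem CompatPath.exists_longer {l : List V} (h : CompatPath G H l) (hHG : H ≤ G)
    (hH : ∀ u v w, H.Adj u v → H.Adj u w → v = w) {u : V} (hu : u ∉ l)
    (hadj : ∀ a, l.head? = some a → G.Adj u a) :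
    ∃ l', CompatPath G H l' ∧ l.length < l'.length := by
  by_cases hw : ∃ w, H.Adj u w
  · obtain ⟨w, huw⟩ := hw
    have hwl : w ∉ l := fun hw => hu (h.compat w u huw.symm hw).mem_right
    refine ⟨w :: u :: l, ⟨?_, ?_, ?_⟩, by simp⟩
    · simp [hu, hwl, h.nodup, huw.ne']
    · rw [isChain_cons_cons, isChain_cons]
      exact ⟨hHG huw.symm, fun y hy => hadj y hy, h.chain⟩
    · intro x y hxy hx
      rw [consec_cons]
      rcases mem_cons.1 hx with rfl | hx
      · obtain rfl := hH _ _ _ huw.symm hxy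
        simp
      rcases mem_cons.1 hx with rfl | hx
      · obtain rfl := hH _ _ _ huw hxy
        simp
      · exact .inl (consec_cons.2 (.inl (h.compat x y hxy hx)))
  · push Not at hw
    refine ⟨u :: l, ⟨?_, ?_, ?_⟩, by simp⟩
    · simp [hu, h.nodup]
    · rw [isChain_cons]
      exact ⟨fun y hy => hadj y hy, h.chain⟩
    · intro x y hxy hx
      rcases mem_cons.1 hx with rfl | hx
      · exact absurd hxy (hw y)
      · exact consec_cons.2 (.inl (h.compat x y hxy hx))

/-- `u` and `v` are consecutive in the cyclic list `C`. -/
def CycConsec (C : List V) (u v : V) : Prop :=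
  Consec C u v ∨ (C.getLast? = some u ∧ C.head? = some v) ∨ (C.getLast? = some v ∧ C.head? = some u)

/-- `C` is the vertex list of a cycle (possibly degenerate) that contains every edge of `H` it
meets. -/
structure CompatCycle (G H : SimpleGraph V) (C : List V) : Prop where
  nodup : C.Nodup
  chain : C.IsChain G.Adj
  close : ∀ u v, C.getLast? = some u → C.head? = some v → G.Adj u v
  compat : ∀ u v, H.Adj u v → u ∈ C → CycConsec C u v

theorem CycConsec.rotate {s t : List V} {u v : V} (h : CycConsec (s ++ t) u v) :
    CycConsec (t ++ s) u v := by
  by_cases hs : s = []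
  · subst hs; simpa using h
  by_cases ht : t = []
  · subst ht; simpa using h
  simp only [CycConsec, consec_append] at h ⊢
  rw [getLast?_append_of_ne_nil _ ht, head?_append_of_ne_nil _ hs] at h
  rw [getLast?_append_of_ne_nil _ hs, head?_append_of_ne_nil _ ht]
  tauto

theorem CompatCycle.rotate {s t : List V} (h : CompatCycle G H (s ++ t)) :
    CompatCycle G H (t ++ s) where
  nodup := nodup_append_comm.1 h.nodup
  chain := by
    rcases s.eq_nil_or_concat with rfl | ⟨s, a, rfl⟩
    · simpa using h.chain
    rcases t with _ | ⟨b, t⟩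
    · simpa using h.chain
    refine isChain_append.2 ⟨h.chain.right_of_append, h.chain.left_of_append, ?_⟩
    intro x hx y hy
    refine h.close x y ?_ ?_
    · rw [getLast?_append_of_ne_nil _ (by simp)]; exact hx
    · rw [head?_append_of_ne_nil _ (by simp)]; exact hy
  close u v hu hv := by
    rcases s.eq_nil_or_concat with rfl | ⟨s, a, rfl⟩
    · exact h.close u v (by simpa using hu) (by simpa using hv)
    rcases t with _ | ⟨b, t⟩
    · exact h.close u v (by simpa using hu) (by simpa using hv)
    refine (isChain_append.1 h.chain).2.2 u ?_ v ?_
    · rw [getLast?_append_of_ne_nil _ (by simp)] at hu; exact hu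
    · rw [head?_append_of_ne_nil _ (by simp)] at hv; exact hv
  compat u v huv hu := (h.compat u v huv (by simpa [or_comm] using hu)).rotate

/-- A cycle respecting a matching can be opened at any vertex. -/
theorem CompatCycle.exists_path {C : List V} (h : CompatCycle G H C)
    (hH : ∀ u v w, H.Adj u v → H.Adj u w → v = w) {c : V} (hc : c ∈ C) :
    ∃ l, CompatPath G H l ∧ l.head? = some c ∧ l.Perm C := by
  obtain ⟨s, r, rfl⟩ := append_of_mem hc
  have hp : (c :: r ++ s).Perm (s ++ c :: r) := perm_append_comm
  replace h := h.rotate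
  revert hp h
  rw [cons_append]
  generalize r ++ s = q
  intro hp h
  -- `H` has at most one edge at `c`. If it is the closing edge, the cycle is traversed backwards
  -- from `c`, which keeps that edge.
  by_cases he : ∃ e, q.getLast? = some e ∧ H.Adj e c
  · obtain ⟨e, he, hec⟩ := he
    refine ⟨c :: q.reverse, ⟨?_, ?_, ?_⟩, rfl, (Perm.cons c (reverse_perm q)).trans hp⟩
    · exact ((Perm.cons c (reverse_perm q)).nodup_iff).2 h.nodup
    · rw [isChain_cons]
      refine ⟨fun y hy => ?_, isChain_reverse.2 (h.chain.of_cons.imp fun _ _ h => h.symm)⟩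
      have hy' : q.getLast? = some y := by rwa [head?_reverse] at hy
      refine (h.close y c ?_ rfl).symm
      rw [getLast?_cons, hy']; rfl
    · intro u v huv hu
      have := h.compat u v huv (by simpa using hu)
      rw [consec_cons, consec_reverse, head?_reverse, he]
      simp only [CycConsec, consec_cons, getLast?_cons, he, head?_cons] at this
      simp only [Option.getD_some, Option.some.injEq] at this ⊢
      rcases this with (h | ⟨rfl, h⟩ | ⟨rfl, h⟩) | ⟨rfl, rfl⟩ | ⟨rfl, rfl⟩
      · exact .inl h
      · exact .inr (.inl ⟨rfl, hH _ _ _ hec.symm huv⟩)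
      · exact .inr (.inr ⟨rfl, hH _ _ _ hec.symm huv.symm⟩)
      · simp
      · simp
  · refine ⟨c :: q, ⟨h.nodup, h.chain, ?_⟩, rfl, hp⟩
    intro u v huv hu
    rcases h.compat u v huv hu with h1 | ⟨h1, h2⟩ | ⟨h1, h2⟩
    · exact h1
    · exfalso
      obtain rfl : c = v := by simpa using h2
      rcases q.eq_nil_or_concat with rfl | ⟨q, e, rfl⟩
      · obtain rfl : c = u := by simpa using h1
        exact H.loopless.irrefl _ huv
      · refine he ⟨u, ?_, huv⟩
        simpa [getLast?_cons] using h1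
    · exfalso
      obtain rfl : c = u := by simpa using h2
      rcases q.eq_nil_or_concat with rfl | ⟨q, e, rfl⟩
      · obtain rfl : c = v := by simpa using h1
        exact H.loopless.irrefl _ huv
      · refine he ⟨v, ?_, huv.symm⟩
        simpa [getLast?_cons] using h1

end Compat

/-! ### From cyclic lists to Hamilton cycles -/

section Hamilton

variable {V : Type*} {G H : SimpleGraph V}

theorem mem_edges_ofSupport {l : List V} (hne : l ≠ []) (hc : l.IsChain G.Adj) {u v : V} :
    s(u, v) ∈ (SimpleGraph.Walk.ofSupport l hne hc).edges ↔ Consec l u v := by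
  match l, hne, hc with
  | [a], hne, hc => simp [SimpleGraph.Walk.ofSupport, not_consec_singleton]
  | a :: b :: l, hne, hc =>
    change s(u, v) ∈ s(a, b) ::
      (SimpleGraph.Walk.ofSupport (b :: l) (cons_ne_nil b l) hc.of_cons).edges ↔ _
    rw [mem_cons, mem_edges_ofSupport (cons_ne_nil b l) hc.of_cons, consec_cons (a := a)]
    simp only [Sym2.eq_iff, head?_cons, Option.some.injEq]
    grind

theorem CompatCycle.exists_isHamiltonianCycle [Fintype V] [DecidableEq V] {C : List V}
    (h : CompatCycle G H C) (hC : 3 ≤ C.length) (hall : ∀ v, v ∈ C) :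
    ∃ (v : V) (c : G.Walk v v), c.IsHamiltonianCycle ∧
      ∀ u w, H.Adj u w → s(u, w) ∈ c.edges := by
  have hne : C ≠ [] := by rintro rfl; simp at hC
  have hadj : G.Adj (C.getLast hne) (C.head hne) :=
    h.close _ _ (getLast?_eq_some_getLast _) (head?_eq_some_head _)
  refine ⟨_, .cons hadj (.ofSupport C hne h.chain), ?_, ?_⟩
  · rw [SimpleGraph.Walk.isHamiltonianCycle_iff_isCycle_and_support_count_tail_eq_one,
      SimpleGraph.Walk.cons_isCycle_iff]
    refine ⟨⟨?_, ?_⟩, ?_⟩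
    · rw [SimpleGraph.Walk.isPath_def, SimpleGraph.Walk.support_ofSupport]
      exact h.nodup
    · rw [mem_edges_ofSupport]
      intro hcon
      -- With three vertices, the last one differs from the first two, so the closing edge is not
      -- already an edge of the path.
      match C, hne, hC, h with
      | c :: d :: e :: r, hne, hC, h =>
        have hnd := h.nodup
        simp only [head_cons] at hcon
        rw [getLast_cons (by simp), getLast_cons (by simp)] at hcon
        have hmem : (e :: r).getLast (by simp) ∈ e :: r := getLast_mem _
        generalize (e :: r).getLast _ = z at hcon hmem
        rw [nodup_cons, nodup_cons] at hnd
        rw [consec_cons] at hcon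
        rcases hcon with h | ⟨h, -⟩ | ⟨-, h⟩
        · exact hnd.1 h.mem_right
        · subst h; exact hnd.1 (mem_cons_of_mem _ hmem)
        · simp only [head?_cons, Option.some.injEq] at h
          subst h; exact hnd.2.1 hmem
    · intro a
      rw [SimpleGraph.Walk.support_cons, tail_cons, SimpleGraph.Walk.support_ofSupport]
      exact count_eq_one_of_mem h.nodup (hall a)
  · intro u w huw
    rw [SimpleGraph.Walk.edges_cons, mem_cons, mem_edges_ofSupport]
    rcases h.compat u w huw (hall u) with h1 | ⟨h1, h2⟩ | ⟨h1, h2⟩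
    · exact .inr h1
    · left
      rw [getLast?_eq_some_getLast hne] at h1
      rw [head?_eq_some_head hne] at h2
      simp only [Option.some.injEq] at h1 h2
      rw [h1, h2]
    · left
      rw [getLast?_eq_some_getLast hne] at h1
      rw [head?_eq_some_head hne] at h2
      simp only [Option.some.injEq] at h1 h2
      rw [h1, h2, Sym2.eq_swap]

end Hamilton

/-! ### Disjoint blocks of a path -/

section Segments

variable {V : Type*}

theorem Unbroken.consec_of_interior {I l : List V} (h : Unbroken I l) (hl : l.Nodup) {x z : V}
    (hx : x ∈ I.tail.dropLast) (hxz : Consec l x z) : Consec I x z := by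
  rcases h with h | h
  · exact hxz.of_mem_interior hl h hx
  · refine (consec_reverse.2 hxz).of_mem_interior (nodup_reverse.2 hl) ?_ hx
    rw [← reverse_infix]; simpa using h

theorem Unbroken.subset {I l : List V} (h : Unbroken I l) {x : V} (hx : x ∈ I) : x ∈ l := by
  rcases h with h | h
  · exact h.subset hx
  · exact h.subset (by simpa using hx)

/-- As `J` avoids `I`, it lies entirely before or entirely after it, and the cut is made at the
corresponding end of `I`. -/
theorem exists_split_of_infix {I J l : List V} (hI : I <:+: l) (hJ : J <:+: l)
    (hI0 : I ≠ []) (hJ0 : J ≠ []) (hd : ∀ x ∈ J, x ∉ I) :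
    ∃ l₁ l₂, l = l₁ ++ l₂ ∧ (I <:+: l₁ ∧ J <:+: l₂ ∨ J <:+: l₁ ∧ I <:+: l₂) := by
  obtain ⟨p, r, rfl⟩ := hI
  rcases I with _ | ⟨x, I⟩
  · exact absurd rfl hI0
  have e : p ++ x :: I ++ r = p ++ x :: (I ++ r) := by simp
  rw [e] at hJ
  rcases infix_split_of_notMem hJ (fun h => hd x h (by simp)) with h | h
  · exact ⟨p, x :: I ++ r, by simp, .inr ⟨h, infix_append_left⟩⟩
  · exact ⟨p ++ x :: I, r, by simp, .inl ⟨infix_append_right,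
      infix_of_disjoint_left h hJ0 (fun y hy hyI => hd y hy (mem_cons_of_mem _ hyI))⟩⟩

theorem exists_split_of_unbroken {I J l : List V} (hI : Unbroken I l) (hJ : Unbroken J l)
    (hI0 : I ≠ []) (hJ0 : J ≠ []) (hd : ∀ x ∈ J, x ∉ I) :
    ∃ l₁ l₂, l = l₁ ++ l₂ ∧
      (Unbroken I l₁ ∧ Unbroken J l₂ ∨ Unbroken J l₁ ∧ Unbroken I l₂) := by
  have key : ∀ I' J' : List V, (I' = I ∨ I' = I.reverse) → (J' = J ∨ J' = J.reverse) →
      I' <:+: l → J' <:+: l → ∃ l₁ l₂, l = l₁ ++ l₂ ∧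
      (Unbroken I l₁ ∧ Unbroken J l₂ ∨ Unbroken J l₁ ∧ Unbroken I l₂) := by
    intro I' J' hI' hJ' h1 h2
    obtain ⟨l₁, l₂, rfl, h⟩ := exists_split_of_infix h1 h2
      (by rcases hI' with rfl | rfl <;> simpa using hI0)
      (by rcases hJ' with rfl | rfl <;> simpa using hJ0)
      (by rcases hI' with rfl | rfl <;> rcases hJ' with rfl | rfl <;> simpa using hd)
    have uI : ∀ {l}, I' <:+: l → Unbroken I l := fun h => by
      rcases hI' with rfl | rfl
      exacts [.inl h, .inr h]
    have uJ : ∀ {l}, J' <:+: l → Unbroken J l := fun h => by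
      rcases hJ' with rfl | rfl
      exacts [.inl h, .inr h]
    exact ⟨l₁, l₂, rfl, h.imp (fun h => ⟨uI h.1, uJ h.2⟩) (fun h => ⟨uJ h.1, uI h.2⟩)⟩
  rcases hI with hI | hI <;> rcases hJ with hJ | hJ
  · exact key _ _ (.inl rfl) (.inl rfl) hI hJ
  · exact key _ _ (.inl rfl) (.inr rfl) hI hJ
  · exact key _ _ (.inr rfl) (.inl rfl) hI hJ
  · exact key _ _ (.inr rfl) (.inr rfl) hI hJ

/-- The `i`-th block of length `m` of a list. -/
def block (l : List V) (m i : ℕ) : List V := (l.drop (i * m)).take m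

theorem block_infix (l : List V) (m i : ℕ) : block l m i <:+: l :=
  (take_prefix _ _).isInfix.trans (drop_suffix _ _).isInfix

theorem length_block {l : List V} {m i k : ℕ} (hi : i < k) (h : k * m ≤ l.length) :
    (block l m i).length = m := by
  have : (i + 1) * m ≤ k * m := Nat.mul_le_mul_right m hi
  simp only [block, length_take, length_drop]
  rw [add_mul, one_mul] at this
  omega

/-- A vertex determines its block, so blocks are disjoint and each pivot spoils at most one of them.
-/
theorem idxOf_div_of_mem_block [DecidableEq V] {l : List V} (hl : l.Nodup) {m i : ℕ} {x : V}
    (hx : x ∈ block l m i) : l.idxOf x / m = i := by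
  obtain ⟨r, hr, rfl⟩ := getElem_of_mem hx
  simp only [block, length_take, length_drop] at hr
  simp only [block, getElem_take, getElem_drop]
  rw [hl.idxOf_getElem]
  have hrm : r < m := by omega
  rw [mul_comm, Nat.mul_add_div (by omega), Nat.div_eq_of_lt hrm, add_zero]

end Segments

/-! ### Closing a longest compatible path to a Hamilton cycle -/

section Structure

variable {V : Type*} {G H : SimpleGraph V}

/-- The vertices covered by `H`. -/
noncomputable def covered [Fintype V] (H : SimpleGraph V) : Finset V :=
  open Classical in Finset.univ.filter fun x => ∃ y, H.Adj x y

theorem mem_covered [Fintype V] {x : V} : x ∈ covered H ↔ ∃ y, H.Adj x y := by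
  simp [covered]

/-- The vertices not covered by `H` that have a neighbour in `X`. -/
noncomputable def freeNbhd [Fintype V] (G H : SimpleGraph V) (X : Finset V) : Finset V :=
  open Classical in Finset.univ.filter fun x => (∀ y, ¬ H.Adj x y) ∧ ∃ v ∈ X, G.Adj v x

theorem mem_freeNbhd [Fintype V] {X : Finset V} {x : V} :
    x ∈ freeNbhd G H X ↔ (∀ y, ¬ H.Adj x y) ∧ ∃ v ∈ X, G.Adj v x := by
  simp [freeNbhd]

theorem exists_longest [Fintype V] : ∃ l, CompatPath G H l ∧
    ∀ l', CompatPath G H l' → l'.length ≤ l.length := by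
  by_contra! h
  have key : ∀ n : ℕ, ∃ l, CompatPath G H l ∧ n ≤ l.length := by
    intro n
    induction n with
    | zero => exact ⟨[], ⟨by simp, by simp, fun _ _ _ h => by simp at h⟩, by simp⟩
    | succ n ih =>
      obtain ⟨l, hl, hn⟩ := ih
      obtain ⟨l', hl', hn'⟩ := h l hl
      exact ⟨l', hl', by omega⟩
  obtain ⟨l, hl, hn⟩ := key (Fintype.card V + 1)
  have := hl.nodup.length_le_card
  omega

/-- If every vertex of a family is bad for few indices on average, some member of a large set is
bad for at most an eighth of the indices. -/
theorem exists_few_bad [Fintype V] {lam k : ℕ} (bad : V → ℕ → Prop)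
    [∀ v i, Decidable (bad v i)]
    (hbad : ∀ i < k, (Finset.univ.filter fun v => bad v i).card ≤ lam) {A : Finset V}
    (hA : 8 * lam ≤ A.card) (hA0 : A.Nonempty) :
    ∃ a ∈ A, 8 * ((Finset.range k).filter fun i => bad a i).card ≤ k := by
  by_contra! h
  have h1 := Finset.sum_card_bipartiteAbove_eq_sum_card_bipartiteBelow (s := A)
    (t := Finset.range k) bad
  have h2 : ∑ b ∈ Finset.range k, (A.bipartiteBelow bad b).card ≤ ∑ b ∈ Finset.range k, lam := by
    refine Finset.sum_le_sum fun i hi => ?_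
    refine le_trans (Finset.card_le_card ?_) (hbad i (Finset.mem_range.1 hi))
    intro v hv
    simp only [Finset.bipartiteBelow, Finset.mem_filter] at hv
    simpa using hv.2
  have h3 : ∑ a ∈ A, k < ∑ a ∈ A, 8 * ((Finset.range k).bipartiteAbove bad a).card :=
    Finset.sum_lt_sum_of_nonempty hA0 (fun a ha => h a ha)
  rw [← Finset.mul_sum, h1] at h3
  simp only [Finset.sum_const, Finset.card_range, smul_eq_mul] at h2 h3
  have h4 : k * (8 * lam) ≤ k * A.card := Nat.mul_le_mul_left k hA
  nlinarith

open Classical in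
/-- `Q` is a set of pivots inside the segment `I` with good expansion properties. -/
structure IsCore (G H : SimpleGraph V) (lam : ℕ) (I : List V) (Q : Finset V) : Prop where
  interior : ∀ x ∈ Q, x ∈ I.tail.dropLast
  unmatched : ∀ x ∈ Q, ∀ y, ¬ H.Adj x y
  expand : ∀ Y : Finset V, Y.Nonempty → Y.card ≤ lam →
      (∀ y ∈ Y, y ∈ Q ∨ ∃ x ∈ Q, Consec I x y) →
        7 * Y.card ≤ (Q.filter fun x => ∃ y ∈ Y, G.Adj y x).card

open Classical in
-- The two ends of `I` and the covered vertices are thrown away; the remaining `21 * lam` vertices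
-- feed `exists_core`.
theorem exists_isCore [Fintype V] {lam : ℕ}
    (hG : ∀ A B : Finset V, lam ≤ A.card → lam ≤ B.card → ∃ a ∈ A, ∃ b ∈ B, G.Adj a b)
    {I : List V} (hI : I.Nodup)
    (hlen : 21 * lam + 2 + (covered H).card ≤ I.length) :
    ∃ Q, IsCore G H lam I Q ∧ lam ≤ Q.card := by
  have hint : I.tail.dropLast.Nodup :=
    hI.sublist ((dropLast_sublist _).trans (tail_sublist _))
  have hcard : I.tail.dropLast.toFinset.card = I.length - 1 - 1 := by
    rw [toFinset_card_of_nodup hint]; simp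
  have hsd := Finset.le_card_sdiff (covered H)
    I.tail.dropLast.toFinset
  obtain ⟨Q, hQ, hQc, hexp⟩ := exists_core hG hI (Q₀ := I.tail.dropLast.toFinset \
    (covered H)) (by omega)
  refine ⟨Q, ⟨fun x hx => ?_, fun x hx y hxy => ?_, hexp⟩, hQc⟩
  · exact mem_toFinset.1 (Finset.mem_sdiff.1 (hQ hx)).1
  · exact (Finset.mem_sdiff.1 (hQ hx)).2 (mem_covered.2 ⟨y, hxy⟩)

/-- If a path splits into two halves, each containing an unbroken segment whose core is adjacent
to the corresponding end of the path, then it can be closed to a cycle. -/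
theorem exists_compatCycle [Fintype V] {lam : ℕ}
    (hG : ∀ A B : Finset V, lam ≤ A.card → lam ≤ B.card → ∃ a ∈ A, ∃ b ∈ B, G.Adj a b)
    {l₁ l₂ I J : List V} (hl : CompatPath G H (l₁ ++ l₂)) {QI QJ : Finset V}
    (hQI : IsCore G H lam I QI) (hQJ : IsCore G H lam J QJ)
    (hI : Unbroken I l₁) (hJ : Unbroken J l₂) {a b x y : V}
    (ha : (l₁ ++ l₂).head? = some a) (hb : (l₁ ++ l₂).getLast? = some b)
    (hx : x ∈ QI) (hax : G.Adj a x) (hy : y ∈ QJ) (hby : G.Adj b y) :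
    ∃ C, CompatCycle G H C ∧ C.Perm (l₁ ++ l₂) := by
  have hn := nodup_append.1 hl.nodup
  have hmI : ∀ {x}, x ∈ QI → x ∈ l₁ := fun hx =>
    hI.subset (mem_of_mem_tail (mem_of_mem_dropLast (hQI.interior _ hx)))
  have hmJ : ∀ {x}, x ∈ QJ → x ∈ l₂ := fun hx =>
    hJ.subset (mem_of_mem_tail (mem_of_mem_dropLast (hQJ.interior _ hx)))
  have hl1 : l₁ ≠ [] := ne_nil_of_mem (hmI hx)
  have hl2 : l₂ ≠ [] := ne_nil_of_mem (hmJ hy)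
  rw [head?_append_of_ne_nil _ hl1] at ha
  rw [getLast?_append_of_ne_nil _ hl2] at hb
  -- Each half is rotated at its outer end only. The inner ends stay fixed, so the halves remain
  -- joined whichever heads are chosen.
  obtain ⟨t₁, h₁⟩ := exists_card_heads (G := G) (l := l₁) (I := I) hn.1
    (fun x hx z h => hI.consec_of_interior hn.1 (hQI.interior x hx) h)
    (fun x hx => hmI hx) hQI.expand ha hx hax
  obtain ⟨t₂, h₂⟩ := exists_card_heads (G := G) (l := l₂.reverse) (I := J)
    (nodup_reverse.2 hn.2.1)
    (fun x hx z h => hJ.consec_of_interior hn.2.1 (hQJ.interior x hx) (consec_reverse.1 h))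
    (fun x hx => by simpa using hmJ hx) hQJ.expand (by rwa [head?_reverse]) hy hby
  obtain ⟨s₁, hs₁, s₂, hs₂, hadj⟩ := hG _ _ h₁ h₂
  obtain ⟨m₁, hr₁, hm₁⟩ := mem_heads.1 hs₁
  obtain ⟨m₂, hr₂, hm₂⟩ := mem_heads.1 hs₂
  have hm1 : m₁ ≠ [] := by rintro rfl; simp at hm₁
  have hm2 : m₂ ≠ [] := by rintro rfl; simp at hm₂
  have hlast := hr₁.getLast?
  have hhead : m₂.reverse.head? = l₂.head? := by
    rw [head?_reverse, hr₂.getLast?, getLast?_reverse]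
  have hperm : (m₁ ++ m₂.reverse).Perm (l₁ ++ l₂) :=
    hr₁.perm.append ((reverse_perm m₂).trans (hr₂.perm.trans (reverse_perm l₂)))
  have hc := isChain_append.1 hl.chain
  have hc2 : m₂.IsChain G.Adj :=
    hr₂.chain (isChain_reverse.2 (hc.2.1.imp fun _ _ h => h.symm))
  refine ⟨m₁ ++ m₂.reverse, ⟨hperm.nodup_iff.2 hl.nodup, isChain_append.2 ⟨hr₁.chain hc.1,
    isChain_reverse.2 (hc2.imp fun _ _ h => h.symm), ?_⟩, ?_, ?_⟩, hperm⟩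
  · rw [hlast, hhead]
    exact hc.2.2
  · intro u v hu hv
    rw [getLast?_append_of_ne_nil _ (by simpa using hm2), getLast?_reverse, hm₂] at hu
    rw [head?_append_of_ne_nil _ hm1, hm₁] at hv
    simp only [Option.some.injEq] at hu hv
    subst hu; subst hv
    exact hadj.symm
  · intro u v huv hu
    have huQI : ∀ {u v}, H.Adj u v → u ∉ (QI : Set V) := fun h hu => hQI.unmatched _ hu _ h
    have huQJ : ∀ {u v}, H.Adj u v → u ∉ (QJ : Set V) := fun h hu => hQJ.unmatched _ hu _ h
    left
    have := hl.compat u v huv (hperm.mem_iff.1 hu)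
    rw [consec_append] at this ⊢
    rw [hlast, hhead, consec_reverse]
    refine this.imp (fun h => hr₁.consec h (huQI huv) (huQI huv.symm)) (Or.imp_left fun h => ?_)
    exact hr₂.consec (consec_reverse.2 h) (huQJ huv) (huQJ huv.symm)

open Classical in
/-- A longest path respecting a matching can be closed to a Hamilton cycle containing the
matching. -/
theorem exists_isHamiltonianCycle_of_growth [Fintype V] [DecidableEq V] {lam T k m : ℕ} (hHG : H ≤ G)
    (hH : ∀ u v w, H.Adj u v → H.Adj u w → v = w) (hlam : 0 < lam)
    (hG : ∀ A B : Finset V, lam ≤ A.card → lam ≤ B.card → ∃ a ∈ A, ∃ b ∈ B, G.Adj a b)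
    (hconn : ∀ U : Finset V, U.Nonempty → U ≠ Finset.univ → ∃ u ∈ U, ∃ v, v ∉ U ∧ G.Adj u v)
    (hgrow : ∀ S : ℕ → Finset V, (S 0).Nonempty → (∀ t, S t ⊆ S (t + 1)) →
      (∀ t, (freeNbhd G H (S t)).card ≤ 3 * (S (t + 1)).card) →
      8 * lam ≤ (S T).card)
    (hm : 21 * lam + 2 + (covered H).card ≤ m)
    (hk : 4 * T + 8 ≤ k) (hkm : k * m + lam ≤ Fintype.card V) :
    ∃ (v : V) (c : G.Walk v v), c.IsHamiltonianCycle ∧ ∀ u w, H.Adj u w → s(u, w) ∈ c.edges := by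
  obtain ⟨l, hl, hmax⟩ := exists_longest (G := G) (H := H)
  -- By maximality, the head of any compatible path on the vertices of `l` has all its neighbours on
  -- `l`.
  have hmem : ∀ l', CompatPath G H l' → l'.Perm l → ∀ a u, l'.head? = some a → G.Adj a u →
      u ∈ l := by
    intro l' hl' hp a u ha hau
    by_contra hu
    obtain ⟨l'', h1, h2⟩ := hl'.exists_longer hHG hH (u := u) (by rwa [hp.mem_iff])
      (fun b hb => by rw [ha] at hb; simp only [Option.some.injEq] at hb; subst hb; exact hau.symm)
    have := hmax l'' h1
    have := hp.length_eq
    omega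
  have hl0 : l ≠ [] := by
    rintro rfl
    have : Nonempty V := by
      rw [← Fintype.card_pos_iff]; omega
    obtain ⟨l', h1, h2⟩ := hl.exists_longer hHG hH (u := Classical.arbitrary V) (by simp) (by simp)
    have := hmax l' h1
    omega
  set Q : Set V := {x | ∀ y, ¬ H.Adj x y} with hQ
  have hrot : ∀ l', CompatPath G H l' → l'.Perm l → 8 * lam ≤ (heads G Q l' T).card := by
    intro l' hl' hp
    refine hgrow (heads G Q l') ?_ (fun t => heads_mono) (fun t => ?_)
    · have : l' ≠ [] := fun h => hl0 (by subst h; exact nil_perm.1 hp)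
      exact ⟨l'.head this, mem_heads.2 ⟨l', rfl, head?_eq_some_head this⟩⟩
    · refine card_near_heads_le hl'.nodup t ?_
      intro x hx
      obtain ⟨hx, v, hv, hvx⟩ := mem_freeNbhd.1 hx
      obtain ⟨l'', hr, hv'⟩ := mem_heads.1 hv
      refine ⟨hx, ?_, v, hv, hvx⟩
      rw [hp.mem_iff]
      exact hmem l'' (hl'.rotN (fun x hx => hx) hr) (hr.perm.trans hp) v x hv' hvx
  -- Otherwise at least `lam` vertices are off `l`, and one of them is adjacent to one of the many
  -- heads.
  have hlen : k * m ≤ l.length := by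
    by_contra! hcon
    have h1 : lam ≤ (Finset.univ \ l.toFinset).card := by
      have := Finset.le_card_sdiff l.toFinset Finset.univ
      have := toFinset_card_le l
      rw [Finset.card_univ] at *
      omega
    obtain ⟨a, ha, b, hb, hab⟩ := hG (heads G Q l T) _
      (by have := hrot l hl (.refl _); omega) h1
    obtain ⟨l', hr, hv⟩ := mem_heads.1 ha
    refine (Finset.mem_sdiff.1 hb).2 (mem_toFinset.2 ?_)
    exact hmem l' (hl.rotN (fun x hx => hx) hr) hr.perm a b hv hab
  have hblock : ∀ i, i < k → ∃ R, IsCore G H lam (block l m i) R ∧ lam ≤ R.card := fun i hi =>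
    exists_isCore hG (hl.nodup.sublist (block_infix l m i).sublist)
      (by rw [length_block hi hlen]; exact hm)
  choose! R hR hRc using hblock
  have hbad : ∀ i < k, (Finset.univ.filter fun v => ¬ ∃ x ∈ R i, G.Adj v x).card ≤ lam := by
    intro i hi
    by_contra hcon
    obtain ⟨a, ha, b, hb, hab⟩ := hG _ _ (not_le.1 hcon).le (hRc i hi)
    exact (Finset.mem_filter.1 ha).2 ⟨b, hb, hab⟩
  have hgood : ∀ l', CompatPath G H l' → l'.Perm l → ∃ a ∈ heads G Q l' T,
      8 * ((Finset.range k).filter fun i => ¬ ∃ x ∈ R i, G.Adj a x).card ≤ k := by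
    intro l' hl' hp
    have := hrot l' hl' hp
    exact exists_few_bad (fun a i => ¬ ∃ x ∈ R i, G.Adj a x) hbad this
      (Finset.card_pos.1 (by omega))
  -- One end is rotated to `a`; the path is then reversed and its other end rotated to `b`, with `a`
  -- fixed.
  obtain ⟨a, ha, haR⟩ := hgood l hl (.refl _)
  obtain ⟨la, hra, hla⟩ := mem_heads.1 ha
  have hlac : CompatPath G H la := hl.rotN (fun x hx => hx) hra
  obtain ⟨b, hb, hbR⟩ := hgood la.reverse hlac.reverse ((reverse_perm la).trans hra.perm)
  obtain ⟨L, hrb, hLb⟩ := mem_heads.1 hb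
  have hL : CompatPath G H L := hlac.reverse.rotN (fun x hx => hx) hrb
  have hLp : L.Perm l := hrb.perm.trans ((reverse_perm la).trans hra.perm)
  have hLa : L.getLast? = some a := by rw [hrb.getLast?, getLast?_reverse, hla]
  obtain ⟨Z₁, hZ₁, hu₁⟩ := hra.unbroken
  obtain ⟨Z₂, hZ₂, hu₂⟩ := hrb.unbroken
  have hcycle : ∃ C, CompatCycle G H C ∧ C.Perm L := by
    let W := (Finset.range k) \ (((Finset.range k).filter fun i => ¬ ∃ x ∈ R i, G.Adj a x) ∪
      ((Finset.range k).filter fun i => ¬ ∃ x ∈ R i, G.Adj b x) ∪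
      (Z₁ ∪ Z₂).image fun x => l.idxOf x / m)
    -- At most `k/8` indices are bad for each of `a` and `b`, and at most `2T` blocks contain a
    -- pivot. This leaves at least `3k/4 - 2T ≥ T + 6`.
    have hW : 1 < W.card := by
      have h1 := Finset.le_card_sdiff (((Finset.range k).filter fun i => ¬ ∃ x ∈ R i, G.Adj a x) ∪
        ((Finset.range k).filter fun i => ¬ ∃ x ∈ R i, G.Adj b x) ∪
        (Z₁ ∪ Z₂).image fun x => l.idxOf x / m) (Finset.range k)
      have h2 := Finset.card_union_le (((Finset.range k).filter fun i => ¬ ∃ x ∈ R i, G.Adj a x) ∪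
        ((Finset.range k).filter fun i => ¬ ∃ x ∈ R i, G.Adj b x))
        ((Z₁ ∪ Z₂).image fun x => l.idxOf x / m)
      have h3 := Finset.card_union_le ((Finset.range k).filter fun i => ¬ ∃ x ∈ R i, G.Adj a x)
        ((Finset.range k).filter fun i => ¬ ∃ x ∈ R i, G.Adj b x)
      have h4 : ((Z₁ ∪ Z₂).image fun x => l.idxOf x / m).card ≤ _ := Finset.card_image_le
      have h5 := Finset.card_union_le Z₁ Z₂
      rw [Finset.card_range] at h1
      change k - _ ≤ W.card at h1
      omega
    obtain ⟨i, hi, j, hj, hij⟩ := Finset.one_lt_card.1 hW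
    have hprop : ∀ i ∈ W, i < k ∧ (∃ x ∈ R i, G.Adj a x) ∧ (∃ x ∈ R i, G.Adj b x) ∧
        Unbroken (block l m i) L := by
      intro i hi
      simp only [W, Finset.mem_sdiff, Finset.mem_union, Finset.mem_filter, Finset.mem_range,
        Finset.mem_image, not_or, not_and, not_not] at hi
      obtain ⟨hik, ⟨h1, h2⟩, h3⟩ := hi
      refine ⟨hik, h1 hik, h2 hik, ?_⟩
      have hZ : ∀ x, x ∈ Z₁ ∨ x ∈ Z₂ → x ∉ block l m i := fun x hx hxi =>
        h3 ⟨x, hx, idxOf_div_of_mem_block hl.nodup hxi⟩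
      exact hu₂ _ (fun x hx => hZ x (.inr hx))
        (hu₁ _ (fun x hx => hZ x (.inl hx)) (.inl (block_infix l m i))).reverse
    obtain ⟨hik, ⟨xa, hxa, hxa'⟩, ⟨xb, hxb, hxb'⟩, hiu⟩ := hprop i hi
    obtain ⟨hjk, ⟨ya, hya, hya'⟩, ⟨yb, hyb, hyb'⟩, hju⟩ := hprop j hj
    have hne : ∀ i < k, block l m i ≠ [] := fun i hi h => by
      have := length_block hi hlen
      rw [h] at this
      simp at this
      omega
    obtain ⟨l₁, l₂, rfl, ⟨h1, h2⟩ | ⟨h1, h2⟩⟩ := exists_split_of_unbroken hiu hju (hne i hik)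
      (hne j hjk) (fun x hxj hxi => hij ((idxOf_div_of_mem_block hl.nodup hxi).symm.trans
        (idxOf_div_of_mem_block hl.nodup hxj)))
    · exact exists_compatCycle hG hL (hR i hik) (hR j hjk) h1 h2 hLb hLa hxb hxb' hya hya'
    · exact exists_compatCycle hG hL (hR j hjk) (hR i hik) h1 h2 hLb hLa hyb hyb' hxa hxa'
  obtain ⟨C, hC, hCL⟩ := hcycle
  have hCl := hCL.trans hLp
  by_cases hall : ∀ v, v ∈ C
  · refine hC.exists_isHamiltonianCycle ?_ hall
    rw [hCl.length_eq]
    nlinarith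
  · exfalso
    push Not at hall
    obtain ⟨w, hw⟩ := hall
    have hC0 : C ≠ [] := by rintro rfl; exact hl0 (nil_perm.1 hCl)
    obtain ⟨u, hu, v, hv, huv⟩ := hconn C.toFinset (by simpa using hC0) (by
      intro h
      exact hw (mem_toFinset.1 (h ▸ Finset.mem_univ w)))
    obtain ⟨l', h1, h2, h3⟩ := hC.exists_path hH (mem_toFinset.1 hu)
    have := hmem l' h1 (h3.trans hCl) u v h2 huv
    exact hv (mem_toFinset.2 (hCl.mem_iff.2 this))

end Structure

end ExpanderGraph

namespace ExpanderGraph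

/-! ### A sparse random subset of a matching -/

section RandomSubset

variable {β V : Type*} [DecidableEq β]

/-- The probability that a `p`-random subset of `E` equals `D`. -/
noncomputable def bernoulliWeight (p : ℝ) (E D : Finset β) : ℝ :=
  (∏ _e ∈ D, p) * ∏ _e ∈ E \ D, (1 - p)

/-- Independence: the expectation of a product over the chosen elements factorises. -/
theorem sum_bernoulliWeight_mul_prod (p : ℝ) (E : Finset β) (f : β → ℝ) :
    ∑ D ∈ E.powerset, bernoulliWeight p E D * ∏ e ∈ D, f e = ∏ e ∈ E, (p * f e + (1 - p)) := by
  rw [Finset.prod_add]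
  refine Finset.sum_congr rfl fun D _ => ?_
  rw [bernoulliWeight, Finset.prod_mul_distrib]
  ring

theorem sum_bernoulliWeight (p : ℝ) (E : Finset β) :
    ∑ D ∈ E.powerset, bernoulliWeight p E D = 1 := by
  simpa using sum_bernoulliWeight_mul_prod p E fun _ => 1

theorem bernoulliWeight_nonneg {p : ℝ} (h0 : 0 ≤ p) (h1 : p ≤ 1) (E D : Finset β) :
    0 ≤ bernoulliWeight p E D :=
  mul_nonneg (Finset.prod_nonneg fun _ _ => h0) (Finset.prod_nonneg fun _ _ => by linarith)

theorem sum_bernoulliWeight_exp_card {p : ℝ} (h0 : 0 ≤ p) (E : Finset β) :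
    ∑ D ∈ E.powerset, bernoulliWeight p E D * Real.exp D.card ≤ Real.exp (2 * p * E.card) := by
  have h : ∀ D : Finset β, Real.exp D.card = ∏ _e ∈ D, Real.exp 1 := fun D => by
    rw [Finset.prod_const, ← Real.exp_nat_mul, mul_one]
  simp_rw [h]
  rw [sum_bernoulliWeight_mul_prod, Finset.prod_const]
  have he : p * Real.exp 1 + (1 - p) ≤ Real.exp (2 * p) := by
    have h1 := Real.exp_one_lt_d9
    have h2 := Real.add_one_le_exp (2 * p)
    nlinarith
  calc (p * Real.exp 1 + (1 - p)) ^ E.card ≤ Real.exp (2 * p) ^ E.card :=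
        pow_le_pow_left₀ (by nlinarith [Real.exp_one_gt_d9]) he _
    _ = _ := by rw [← Real.exp_nat_mul]; congr 1; ring

theorem sum_bernoulliWeight_exp_neg_card_inter {p : ℝ} (h0 : 0 ≤ p) (h1 : p ≤ 1)
    {E E' : Finset β} (hE : E' ⊆ E) :
    ∑ D ∈ E.powerset, bernoulliWeight p E D * Real.exp (-((D ∩ E').card : ℝ)) ≤
      Real.exp (-(p * E'.card / 2)) := by
  have h : ∀ D : Finset β, Real.exp (-((D ∩ E').card : ℝ)) =
      ∏ e ∈ D, if e ∈ E' then Real.exp (-1) else 1 := fun D => by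
    rw [Finset.prod_ite_mem, Finset.prod_const, ← Real.exp_nat_mul]
    congr 1; ring
  simp_rw [h]
  rw [sum_bernoulliWeight_mul_prod]
  have h2 : ∀ e, p * (if e ∈ E' then Real.exp (-1) else 1) + (1 - p) =
      if e ∈ E' then p * Real.exp (-1) + (1 - p) else 1 := fun e => by
    split_ifs <;> ring
  simp_rw [h2]
  rw [Finset.prod_ite_mem, Finset.inter_eq_right.2 hE, Finset.prod_const]
  have he : p * Real.exp (-1) + (1 - p) ≤ Real.exp (-(p / 2)) := by
    have h1 : Real.exp (-1) ≤ 1 / 2 := by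
      rw [Real.exp_neg, one_div]
      exact inv_anti₀ (by norm_num) (by linarith [Real.exp_one_gt_d9])
    have h2 := Real.add_one_le_exp (-(p / 2))
    nlinarith
  calc (p * Real.exp (-1) + (1 - p)) ^ E'.card ≤ Real.exp (-(p / 2)) ^ E'.card :=
        pow_le_pow_left₀ (by nlinarith [Real.exp_pos (-1)]) he _
    _ = _ := by rw [← Real.exp_nat_mul]; congr 1; ring

/-- A small subset `D` of `E` meeting every `E' X` in proportion to `|X|`. -/
theorem exists_sparse_subset [Fintype V] {E : Finset β} {E' : Finset V → Finset β}
    {F : Finset (Finset V)} {p r τ : ℝ} (h0 : 0 ≤ p) (h1 : p ≤ 1) (hE : 2 ≤ p * E.card)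
    (hF : ∀ X ∈ F, X.Nonempty) (hE' : ∀ X ∈ F, E' X ⊆ E)
    (hr : ∀ X ∈ F, r * X.card ≤ (E' X).card)
    (hlog : Real.log (4 * Fintype.card V) ≤ p * r / 2 - τ) :
    ∃ D ⊆ E, (D.card : ℝ) ≤ 4 * p * E.card ∧ ∀ X ∈ F, τ * X.card ≤ (D ∩ E' X).card := by
  classical
  by_contra! hcon
  rcases isEmpty_or_nonempty V with hV | hV
  · obtain ⟨D, hD, hDE⟩ : ∃ D ⊆ E, (D.card : ℝ) ≤ 4 * p * E.card :=
      ⟨∅, by simp, by simp; positivity⟩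
    obtain ⟨X, hX, -⟩ := hcon D hD hDE
    obtain ⟨v, -⟩ := hF X hX
    exact hV.elim v
  have hn : (0 : ℝ) < Fintype.card V := by exact_mod_cast Fintype.card_pos
  set q : ℝ := 1 / (4 * Fintype.card V) with hq
  have hq0 : 0 < q := by positivity
  -- Chernoff penalties: every failure of `D` makes one summand at least 1, while the expectation of
  -- `B` is at most 2/3.
  let B : Finset β → ℝ := fun D => Real.exp (D.card) * Real.exp (-(4 * p * E.card)) +
    ∑ X ∈ F, Real.exp (-((D ∩ E' X).card : ℝ)) * Real.exp (τ * X.card)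
  have hB : ∀ D ∈ E.powerset, 1 ≤ B D := by
    intro D hD
    have hs : 0 ≤ ∑ X ∈ F, Real.exp (-((D ∩ E' X).card : ℝ)) * Real.exp (τ * X.card) :=
      Finset.sum_nonneg fun X _ => by positivity
    by_cases hDE : (D.card : ℝ) ≤ 4 * p * E.card
    · obtain ⟨X, hX, hlt⟩ := hcon D (Finset.mem_powerset.1 hD) hDE
      have h2 : 1 ≤ Real.exp (-((D ∩ E' X).card : ℝ)) * Real.exp (τ * X.card) := by
        rw [← Real.exp_add]
        exact Real.one_le_exp (by linarith)
      have h3 := Finset.single_le_sum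
        (f := fun X => Real.exp (-((D ∩ E' X).card : ℝ)) * Real.exp (τ * X.card))
        (fun X _ => by positivity) hX
      have : 0 ≤ Real.exp (D.card) * Real.exp (-(4 * p * E.card)) := by positivity
      simp only [B]
      linarith
    · have : 1 ≤ Real.exp (D.card) * Real.exp (-(4 * p * E.card)) := by
        rw [← Real.exp_add]
        exact Real.one_le_exp (by linarith)
      simp only [B]
      linarith
  have hlow : 1 ≤ ∑ D ∈ E.powerset, bernoulliWeight p E D * B D := by
    rw [← sum_bernoulliWeight p E]
    refine Finset.sum_le_sum fun D hD => ?_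
    exact le_mul_of_one_le_right (bernoulliWeight_nonneg h0 h1 E D) (hB D hD)
  have hexpand : ∑ D ∈ E.powerset, bernoulliWeight p E D * B D =
      (∑ D ∈ E.powerset, bernoulliWeight p E D * Real.exp D.card) *
        Real.exp (-(4 * p * E.card)) +
      ∑ X ∈ F, (∑ D ∈ E.powerset, bernoulliWeight p E D * Real.exp (-((D ∩ E' X).card : ℝ))) *
        Real.exp (τ * X.card) := by
    simp only [B, mul_add, Finset.sum_add_distrib, Finset.mul_sum, Finset.sum_mul]
    congr 1
    · exact Finset.sum_congr rfl fun D _ => by ring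
    · rw [Finset.sum_comm]
      exact Finset.sum_congr rfl fun X _ => Finset.sum_congr rfl fun D _ => by ring
  have hfirst : (∑ D ∈ E.powerset, bernoulliWeight p E D * Real.exp D.card) *
        Real.exp (-(4 * p * E.card)) ≤ 1 / 3 := by
    have h2 := mul_le_mul_of_nonneg_right (sum_bernoulliWeight_exp_card h0 E)
      (Real.exp_pos (-(4 * p * E.card))).le
    refine h2.trans ?_
    rw [← Real.exp_add]
    calc Real.exp (2 * p * E.card + -(4 * p * E.card)) ≤ Real.exp (-2) :=
          Real.exp_le_exp.2 (by linarith)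
      _ ≤ 1 / 3 := by
          rw [Real.exp_neg, one_div]
          exact inv_anti₀ (by norm_num) (by linarith [Real.add_one_le_exp (2 : ℝ)])
  have hsecond : ∑ X ∈ F, (∑ D ∈ E.powerset, bernoulliWeight p E D *
      Real.exp (-((D ∩ E' X).card : ℝ))) * Real.exp (τ * X.card) ≤ 1 / 3 := by
    have h2 : ∀ X ∈ F, (∑ D ∈ E.powerset, bernoulliWeight p E D *
        Real.exp (-((D ∩ E' X).card : ℝ))) * Real.exp (τ * X.card) ≤ q ^ X.card := by
      intro X hX
      refine (mul_le_mul_of_nonneg_right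
        (sum_bernoulliWeight_exp_neg_card_inter h0 h1 (hE' X hX)) (Real.exp_pos _).le).trans ?_
      have hqe : q = Real.exp (-Real.log (4 * Fintype.card V)) := by
        rw [Real.exp_neg, Real.exp_log (by positivity), hq, one_div]
      rw [← Real.exp_add, hqe, ← Real.exp_nat_mul]
      refine Real.exp_le_exp.2 ?_
      have h3 := mul_le_mul_of_nonneg_left (hr X hX) h0
      have h4 := mul_le_mul_of_nonneg_left hlog (Nat.cast_nonneg X.card : (0 : ℝ) ≤ X.card)
      nlinarith
    -- The union bound over nonempty `X` is `(1 + q)^n - 1 ≤ exp (1/4) - 1 ≤ 1/3`.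
    refine (Finset.sum_le_sum h2).trans ?_
    have h3 : ∑ X ∈ F, q ^ X.card + q ^ (∅ : Finset V).card ≤
        ∑ X : Finset V, q ^ X.card := by
      rw [add_comm, ← Finset.sum_insert (f := fun X : Finset V => q ^ X.card)
        (fun h => by simpa using hF ∅ h)]
      exact Finset.sum_le_sum_of_subset_of_nonneg (Finset.subset_univ _)
        fun X _ _ => by positivity
    have h4 : ∑ X : Finset V, q ^ X.card = (q + 1) ^ Fintype.card V := by
      simpa using Fintype.sum_pow_mul_eq_add_pow V q 1
    have h5 : (q + 1) ^ Fintype.card V ≤ Real.exp (1 / 4) := by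
      calc (q + 1) ^ Fintype.card V ≤ Real.exp q ^ Fintype.card V :=
            pow_le_pow_left₀ (by positivity) (Real.add_one_le_exp q) _
        _ = Real.exp (1 / 4) := by
            rw [← Real.exp_nat_mul, hq]
            congr 1
            field_simp
    have h6 : Real.exp (1 / 4) ≤ 4 / 3 := by
      have h7 := Real.add_one_le_exp (-(1 / 4) : ℝ)
      have h8 : Real.exp (1 / 4) * Real.exp (-(1 / 4)) = 1 := by rw [← Real.exp_add]; simp
      nlinarith [Real.exp_pos (1 / 4)]
    simp only [Finset.card_empty, pow_zero] at h3
    linarith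
  linarith

end RandomSubset

/-! ### Freeing vertices by deleting matching edges -/

section Deletion

variable {V : Type*} [Fintype V] {G H : SimpleGraph V}

open Classical in
theorem card_support_inter_le (A : Finset V) :
    (A.filter fun x => ∃ y, H.Adj x y).card ≤
      2 * (H.edgeFinset.filter fun e => ∃ x ∈ e, x ∈ A).card := by
  have hsub : (A.filter fun x => ∃ y, H.Adj x y) ⊆
      (H.edgeFinset.filter fun e => ∃ x ∈ e, x ∈ A).biUnion Sym2.toFinset := by
    intro x hx
    obtain ⟨hx, y, hxy⟩ := Finset.mem_filter.1 hx
    refine Finset.mem_biUnion.2 ⟨s(x, y), Finset.mem_filter.2 ⟨?_, x, by simp, hx⟩, by simp⟩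
    simpa using hxy
  refine (Finset.card_le_card hsub).trans ?_
  rw [mul_comm]
  refine Finset.card_biUnion_le_card_mul _ _ _ fun e _ => ?_
  rw [Sym2.card_toFinset]
  split_ifs <;> omega

open Classical in
theorem card_edgeFinset_eq_ncard : H.edgeFinset.card = H.edgeSet.ncard := by
  rw [← Set.ncard_coe_finset, SimpleGraph.coe_edgeFinset]

open Classical in
theorem card_support_le {H' : SimpleGraph V} (h : H' ≤ H) :
    (covered H').card ≤ 2 * H.edgeSet.ncard := by
  rw [← card_edgeFinset_eq_ncard]
  have h1 : covered H' ⊆ Finset.univ.filter fun x => ∃ y, H.Adj x y := fun x hx =>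
    Finset.mem_filter.2 ⟨Finset.mem_univ _, (mem_covered.1 hx).imp fun _ hy => h hy⟩
  exact (Finset.card_le_card h1).trans ((card_support_inter_le _).trans
    (Nat.mul_le_mul_left 2 (Finset.card_filter_le _ _)))

open Classical in
/-- Deleting few edges from a matching, one can ensure that small sets expand into the unmatched
vertices. -/
theorem exists_deletion (hH : ∀ u v w, H.Adj u v → H.Adj u w → v = w) {p r τ g : ℝ}
    (hp0 : 0 < p) (hp1 : p ≤ 1)
    (hexp : ∀ X : Finset V, (X.card : ℝ) ≤ g → 4 * r * X.card ≤ (nbhd G X).card)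
    (hτ : τ ≤ 2 * r) (hpr : 4 / p ≤ 2 * r)
    (hlog : Real.log (4 * Fintype.card V) ≤ p * r / 2 - τ) :
    ∃ D : Finset (Sym2 V), (D.card : ℝ) ≤ 4 * p * H.edgeSet.ncard ∧
      ∀ X : Finset V, (X.card : ℝ) ≤ g → τ * X.card ≤
        ((freeNbhd G (H.deleteEdges D) X).card : ℝ) := by
  rw [← card_edgeFinset_eq_ncard]
  have hnb : ∀ X x, x ∈ nbhd G X → ∃ v ∈ X, G.Adj v x := by
    intro X x hx
    simp only [nbhd, Finset.mem_filter] at hx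
    exact hx.2.2
  have hsplit : ∀ X, ((nbhd G X).card : ℝ) = ((nbhd G X).filter fun x => ∃ y, H.Adj x y).card +
      ((nbhd G X).filter fun x => ¬ ∃ y, H.Adj x y).card := by
    intro X
    exact_mod_cast (Finset.card_filter_add_card_filter_not _).symm
  have hfree : ∀ (D : Finset (Sym2 V)) X, (((nbhd G X).filter fun x => ¬ ∃ y, H.Adj x y).card : ℝ) ≤
      ((freeNbhd G (H.deleteEdges D) X).card : ℝ) := by
    intro D X
    refine Nat.cast_le.2 (Finset.card_le_card fun x hx => ?_)
    obtain ⟨hx, hx'⟩ := Finset.mem_filter.1 hx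
    refine mem_freeNbhd.2 ⟨fun y hy => hx' ⟨y, ?_⟩, hnb X x hx⟩
    exact H.deleteEdges_le _ hy
  by_cases hE : 2 ≤ p * H.edgeFinset.card
  · obtain ⟨D, hD, hDc, hDX⟩ := exists_sparse_subset (V := V) (E := H.edgeFinset)
      (E' := fun X => H.edgeFinset.filter fun e => ∃ x ∈ e, x ∈ nbhd G X)
      -- Only these `X` need help: more than `2r|X|` of their neighbours are covered, so at least
      -- `r|X|` edges meet N(X).
      (F := Finset.univ.filter fun X : Finset V => X.Nonempty ∧ (X.card : ℝ) ≤ g ∧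
        (((nbhd G X).filter fun x => ¬ ∃ y, H.Adj x y).card : ℝ) < 2 * r * X.card)
      hp0.le hp1 hE (fun X hX => (Finset.mem_filter.1 hX).2.1)
      (fun X _ => Finset.filter_subset _ _) (r := r) (fun X hX => by
        obtain ⟨-, -, hXg, hX⟩ := Finset.mem_filter.1 hX
        have h1 := hexp X hXg
        rw [hsplit] at h1
        have h2 : (((nbhd G X).filter fun x => ∃ y, H.Adj x y).card : ℝ) ≤
          2 * (H.edgeFinset.filter fun e => ∃ x ∈ e, x ∈ nbhd G X).card := by
          exact_mod_cast card_support_inter_le (H := H) (nbhd G X)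
        linarith) hlog
    refine ⟨D, hDc, fun X hXg => ?_⟩
    rcases X.eq_empty_or_nonempty with rfl | hXne
    · simp
    by_cases hX : (((nbhd G X).filter fun x => ¬ ∃ y, H.Adj x y).card : ℝ) < 2 * r * X.card
    · refine (hDX X (Finset.mem_filter.2 ⟨Finset.mem_univ _, hXne, hXg, hX⟩)).trans ?_
      -- Each deleted edge meeting N(X) frees an end there, and distinct matching edges free
      -- distinct vertices.
      refine Nat.cast_le.2 (Finset.card_le_card_of_forall_subsingleton (fun e x => x ∈ e) ?_ ?_)
      · intro e he
        obtain ⟨heD, he⟩ := Finset.mem_inter.1 he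
        obtain ⟨heE, x, hxe, hx⟩ := Finset.mem_filter.1 he
        refine ⟨x, mem_freeNbhd.2 ⟨fun y hy => ?_, hnb X x hx⟩, hxe⟩
        rw [SimpleGraph.deleteEdges_adj] at hy
        obtain ⟨z, rfl⟩ := Sym2.mem_iff_exists.1 hxe
        obtain rfl := hH x z y (by simpa using heE) hy.1
        exact hy.2 heD
      · intro x _ e he e' he'
        obtain ⟨z, rfl⟩ := Sym2.mem_iff_exists.1 he.2
        obtain ⟨z', rfl⟩ := Sym2.mem_iff_exists.1 he'.2
        have h1 := hD (Finset.mem_inter.1 he.1).1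
        have h2 := hD (Finset.mem_inter.1 he'.1).1
        rw [hH x z z' (by simpa using h1) (by simpa using h2)]
    · have h1 := hfree D X
      have h2 := mul_le_mul_of_nonneg_right hτ (Nat.cast_nonneg X.card : (0 : ℝ) ≤ X.card)
      linarith
  -- A matching with fewer than `2/p` edges covers at most `4/p ≤ 2r` vertices, so nothing has to be
  -- deleted.
  · refine ⟨∅, by simp; positivity, fun X hXg => ?_⟩
    rcases X.eq_empty_or_nonempty with rfl | hXne
    · simp
    have hX1 : (1 : ℝ) ≤ X.card := by exact_mod_cast hXne.card_pos
    have h1 := hfree ∅ X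
    have h2 := hexp X hXg
    rw [hsplit] at h2
    have h3 : (((nbhd G X).filter fun x => ∃ y, H.Adj x y).card : ℝ) ≤
        2 * H.edgeFinset.card := by
      exact_mod_cast (card_support_inter_le (H := H) (nbhd G X)).trans
        (Nat.mul_le_mul_left 2 (Finset.card_filter_le _ _))
    have h4 : (H.edgeFinset.card : ℝ) ≤ 2 / p := by
      rw [le_div_iff₀ hp0]
      linarith
    have h5 : 2 * (2 / p) ≤ 2 * r := by
      rw [← mul_div_assoc]; norm_num; exact hpr
    have hr0 : 0 ≤ r := by
      have : 0 ≤ 4 / p := by positivity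
      linarith
    nlinarith

end Deletion

end ExpanderGraph

namespace ExpanderGraph

/-! ### Consequences of the expander properties -/

section Expander

variable {V : Type*} {G H : SimpleGraph V}

/-- Doubling the size removes the disjointness requirement: two sets this large contain disjoint
subsets of size `⌈l⌉₊`. -/
theorem LargeExpander.exists_adj {l : ℝ} (h : LargeExpander G l) {A B : Finset V}
    (hA : 2 * ⌈l⌉₊ ≤ A.card) (hB : 2 * ⌈l⌉₊ ≤ B.card) : ∃ a ∈ A, ∃ b ∈ B, G.Adj a b := by
  classical
  have hl : ∀ {C : Finset V}, ⌈l⌉₊ ≤ C.card → l ≤ C.card := fun h => Nat.ceil_le.1 h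
  by_cases hd : ⌈l⌉₊ ≤ (A \ B).card
  · obtain ⟨a, ha, b, hb, hab⟩ := h (A \ B) B Finset.sdiff_disjoint (hl hd) (hl (by omega))
    exact ⟨a, (Finset.mem_sdiff.1 ha).1, b, hb, hab⟩
  · have h1 := Finset.card_sdiff_add_card_inter A B
    obtain ⟨A', hA', hA'c⟩ := Finset.exists_subset_card_eq (s := A ∩ B) (n := ⌈l⌉₊) (by omega)
    have h2 := Finset.le_card_sdiff A' B
    obtain ⟨a, ha, b, hb, hab⟩ := h A' (B \ A') Finset.disjoint_sdiff (hl hA'c.ge)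
      (hl (by omega))
    exact ⟨a, (Finset.mem_inter.1 (hA' ha)).1, b, (Finset.mem_sdiff.1 hb).1, hab⟩

variable [Fintype V]

theorem mem_nbhd {A : Finset V} {v : V} : v ∈ nbhd G A ↔ v ∉ A ∧ ∃ a ∈ A, G.Adj a v := by
  simp [nbhd]

/-- A set of size at least `g` has a subset of size at most `g` with at least `s g / 2`
neighbours. -/
theorem SmallExpander.exists_subset {s g : ℝ} (h : SmallExpander G s g) (hs : 0 < s) (hg : 1 ≤ g)
    {W : Finset V} (hW : g ≤ W.card) : ∃ X ⊆ W, s * g / 2 ≤ (nbhd G X).card := by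
  have hfl : ⌊g⌋₊ ≤ W.card := by
    exact_mod_cast (Nat.floor_le (by linarith)).trans hW
  obtain ⟨X, hXW, hX⟩ := Finset.exists_subset_card_eq hfl
  refine ⟨X, hXW, le_trans ?_ (h X (by rw [hX]; exact Nat.floor_le (by linarith)))⟩
  have h1 : g < ⌊g⌋₊ + 1 := Nat.lt_floor_add_one g
  have h2 : (1 : ℝ) ≤ ⌊g⌋₊ := by exact_mod_cast Nat.floor_pos.2 hg
  rw [hX]
  nlinarith

/-- This is connectivity. If `U` and its complement both have size at least `l`, the large expander
property applies. Otherwise the smaller than `l` one expands: a set closed under adjacency with more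
than `g` vertices has at least `s g / 2 ≥ l`. -/
theorem IsExpander.exists_adj_notMem {s g l : ℝ} (h : IsExpander G s g l) (hs : 0 < s)
    (hg : 1 ≤ g) (hl : l ≤ s * g / 2) {U : Finset V} (hU : U.Nonempty) (hU' : U ≠ Finset.univ) :
    ∃ u ∈ U, ∃ v, v ∉ U ∧ G.Adj u v := by
  classical
  have hsmall : ∀ W : Finset V, W.Nonempty → (W.card : ℝ) < l → ∃ u ∈ W, ∃ v, v ∉ W ∧ G.Adj u v := by
    intro W hW hWl
    by_contra! hcon
    by_cases hWg : (W.card : ℝ) ≤ g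
    · have h1 := h.1 W hWg
      have h2 : (0 : ℝ) < W.card := by exact_mod_cast hW.card_pos
      have h3 : (0 : ℝ) < (nbhd G W).card := lt_of_lt_of_le (by positivity) h1
      obtain ⟨v, hv⟩ := Finset.card_pos.1 (by exact_mod_cast h3 : 0 < (nbhd G W).card)
      obtain ⟨hv, a, ha, hav⟩ := mem_nbhd.1 hv
      exact hcon a ha v hv hav
    · obtain ⟨X, hXW, hX⟩ := h.1.exists_subset hs hg (not_le.1 hWg).le
      have hsub : nbhd G X ⊆ W := by
        intro v hv
        obtain ⟨-, a, ha, hav⟩ := mem_nbhd.1 hv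
        by_contra hvW
        exact hcon a (hXW ha) v hvW hav
      have : ((nbhd G X).card : ℝ) ≤ W.card := by exact_mod_cast Finset.card_le_card hsub
      linarith
  by_cases h1 : (U.card : ℝ) < l
  · exact hsmall U hU h1
  · by_cases h2 : ((Uᶜ).card : ℝ) < l
    · obtain ⟨u, hu, v, hv, huv⟩ := hsmall Uᶜ
        (Finset.nonempty_iff_ne_empty.2 fun h => hU' (Finset.compl_eq_empty_iff _ |>.1 h)) h2
      exact ⟨v, by simpa using hv, u, by simpa using hu, huv.symm⟩
    · obtain ⟨a, ha, b, hb, hab⟩ := h.2 U Uᶜ disjoint_compl_right (not_lt.1 h1) (not_lt.1 h2)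
      exact ⟨a, ha, b, by simpa using hb, hab⟩

open Classical in
/-- Sets growing under rotations become large after boundedly many rounds. -/
theorem card_of_growth {s g x : ℝ} {lam T : ℕ} (h : SmallExpander G s g) (hs : 0 < s)
    (hg : 1 ≤ g)
    (hexp : ∀ X : Finset V, (X.card : ℝ) ≤ g → 3 * x * X.card ≤
      ((freeNbhd G H X).card : ℝ))
    (hx : 0 ≤ x) (hxT : (Fintype.card V : ℝ) < x ^ T)
    (hbig : 24 * (lam : ℝ) + (covered H).card ≤ s * g / 2)
    (S : ℕ → Finset V) (hS0 : (S 0).Nonempty) (hmono : ∀ t, S t ⊆ S (t + 1))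
    (hS : ∀ t, (freeNbhd G H (S t)).card ≤
      3 * (S (t + 1)).card) : 8 * lam ≤ (S T).card := by
  have key : ∀ t, x ^ t ≤ (S t).card ∨ 8 * lam ≤ (S t).card := by
    intro t
    induction t with
    | zero => left; simpa using hS0.card_pos
    | succ t ih =>
      have hSt : ((freeNbhd G H (S t)).card : ℝ) ≤ 3 * (S (t + 1)).card := by exact_mod_cast hS t
      rcases ih with ih | ih
      · by_cases hSg : ((S t).card : ℝ) ≤ g
        · left
          have h1 := hexp _ hSg
          rw [pow_succ]
          nlinarith
        -- Beyond `g`, a subset of `S t` already has `s g / 2` neighbours. At least `24 * lam` of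
        -- them are free, and the factor 3 leaves `8 * lam`.
        · right
          obtain ⟨X, hXS, hX⟩ := h.exists_subset hs hg (not_le.1 hSg).le
          have hsub : nbhd G X ⊆ freeNbhd G H (S t) ∪ covered H := by
            intro y hy
            obtain ⟨-, a, ha, hay⟩ := mem_nbhd.1 hy
            by_cases hz : ∃ z, H.Adj y z
            · exact Finset.mem_union_right _ (mem_covered.2 hz)
            · push Not at hz
              exact Finset.mem_union_left _ (mem_freeNbhd.2 ⟨hz, a, hXS ha, hay⟩)
          have h1 := (Finset.card_le_card hsub).trans (Finset.card_union_le _ _)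
          have h2 : ((nbhd G X).card : ℝ) ≤ ((freeNbhd G H (S t)).card : ℝ) +
              (covered H).card := by exact_mod_cast h1
          have h3 : (8 * lam : ℝ) ≤ (S (t + 1)).card := by linarith
          exact_mod_cast h3
      · exact .inr (ih.trans (Finset.card_le_card (hmono t)))
  rcases key T with h1 | h1
  · exfalso
    have h2 : ((S T).card : ℝ) ≤ Fintype.card V := by exact_mod_cast Finset.card_le_univ _
    linarith
  · exact h1

end Expander

/-! ### The asymptotic estimates -/

section Asymptotics

open Filter

theorem eventually_estimates {α : ℝ} (hα0 : 0 < α) (hα1 : α ≤ 1) :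
    ∀ᶠ n : ℕ in atTop, 2 ≤ n ∧ 48 ≤ (n : ℝ) ^ (α / 4) ∧ Real.log n ≤ (n : ℝ) ^ (α / 4) ∧
      1 ≤ 4 * α * (n : ℝ) / (n : ℝ) ^ α ∧ 10000 ≤ α * n := by
  have hcast : Tendsto (fun n : ℕ => (n : ℝ)) atTop atTop := tendsto_natCast_atTop_atTop
  refine (eventually_ge_atTop 2).and (.and ?_ (.and ?_ (.and ?_ ?_)))
  · exact ((tendsto_rpow_atTop (by positivity : 0 < α / 4)).comp hcast).eventually_ge_atTop 48
  · have h := (isLittleO_log_rpow_atTop (by positivity : 0 < α / 4)).bound one_pos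
    filter_upwards [hcast.eventually h, eventually_ge_atTop 1] with n hn hn1
    rw [one_mul, Real.norm_of_nonneg (Real.log_nonneg (by exact_mod_cast hn1)),
      Real.norm_of_nonneg (by positivity)] at hn
    exact hn
  · rcases hα1.lt_or_eq with h1 | rfl
    · have h := ((tendsto_rpow_atTop (by linarith : 0 < 1 - α)).comp hcast).eventually_ge_atTop
        (1 / (4 * α))
      filter_upwards [h, eventually_ge_atTop 1] with n hn hn1
      have hn0 : (0 : ℝ) < n := by exact_mod_cast hn1
      simp only [Function.comp_apply] at hn
      rw [div_le_iff₀ (by positivity), Real.rpow_sub hn0, Real.rpow_one] at hn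
      calc (1 : ℝ) ≤ n / (n : ℝ) ^ α * (4 * α) := hn
        _ = _ := by ring
    · filter_upwards [eventually_ge_atTop 1] with n hn1
      have hn0 : (0 : ℝ) < n := by exact_mod_cast hn1
      rw [Real.rpow_one, mul_one, mul_div_assoc, div_self hn0.ne']
      norm_num
  · exact (hcast.const_mul_atTop hα0).eventually_ge_atTop 10000

/-- Used with `x = n^(α/4)`, `y = log n`, `p = 1/x²`, `r = x⁴/4`, `τ = 3x`. The last bound is `x²/8
≥ 6x ≥ 3x + 3 + y`, where 3 bounds `log 4`. -/
theorem deletion_estimates {x y : ℝ} (hx : 48 ≤ x) (hy : y ≤ x) :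
    0 < 1 / x ^ 2 ∧ 1 / x ^ 2 ≤ 1 ∧ 3 * x ≤ 2 * (x ^ 4 / 4) ∧ 4 / (1 / x ^ 2) ≤ 2 * (x ^ 4 / 4) ∧
      3 + y ≤ 1 / x ^ 2 * (x ^ 4 / 4) / 2 - 3 * x := by
  have hx0 : 0 < x := by linarith
  have h2 : 48 * x ≤ x ^ 2 := by rw [pow_two]; exact mul_le_mul_of_nonneg_right hx hx0.le
  have h4 : 48 * x ^ 2 ≤ x ^ 4 := by
    have : x ^ 4 = x ^ 2 * x ^ 2 := by ring
    rw [this]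
    exact mul_le_mul_of_nonneg_right (by linarith) (by positivity)
  refine ⟨by positivity, ?_, by linarith, ?_, ?_⟩
  · rw [div_le_one (by positivity)]; linarith
  · rw [div_div_eq_mul_div, div_one]; linarith
  · have h5 : 1 / x ^ 2 * (x ^ 4 / 4) / 2 = x ^ 2 / 8 := by field_simp; norm_num
    rw [h5]; linarith

/-- The blocks fit into the path: there are at most `28/α` of them, each of length at most `αn/50`.
-/
theorem size_estimate {α n lam T h : ℝ} (hα0 : 0 < α) (hα1 : α ≤ 1) (hαn : 10000 ≤ α * n)
    (hn0 : 0 < n) (hlam0 : 0 ≤ lam) (h0 : 0 ≤ h) (hlam : lam ≤ α * n / 1500 + 2)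
    (hT : T ≤ 4 / α + 1)
    (hh : h ≤ α * n / 4600) : (4 * T + 8) * (21 * lam + 2 + h) + lam ≤ n := by
  have hk : 4 * T + 8 ≤ 28 / α := by
    have : 1 ≤ 1 / α := by rw [le_div_iff₀ hα0]; linarith
    have h28 : 28 / α = 4 * (4 / α) + 12 * (1 / α) := by ring
    linarith
  have hm : 21 * lam + 2 + h ≤ α * n / 50 := by linarith
  have h2 := mul_le_mul hk hm (by positivity) (by positivity)
  have h3 : 28 / α * (α * n / 50) = 28 * n / 50 := by field_simp
  have h4 : α * n ≤ n := mul_le_of_le_one_left hn0.le hα1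
  linarith

end Asymptotics

end ExpanderGraph

/-! ### Choice of parameters and conclusion -/

theorem mainTheorem4 (α : ℝ) (hα0 : 0 < α) (hα1 : α ≤ 1) :
    ∃ n₀ : ℕ, ∀ n : ℕ, n₀ ≤ n →
      ∀ (V : Type*) [Fintype V] [DecidableEq V], Fintype.card V = n →
      ∀ G : SimpleGraph V, ExpanderGraph.IsSExpander G ((n : ℝ) ^ α) →
      ∀ M : G.Subgraph, M.IsMatching → (M.edgeSet.ncard : ℝ) ≤ α ^ 3 * (n : ℝ) / 9200 →
        ∃ (v : V) (C : G.Walk v v), C.IsHamiltonianCycle ∧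
          (M.edgeSet \ {e | e ∈ C.edges}).ncard ≤
            ⌊1036 * (M.edgeSet.ncard : ℝ) / (α ^ 3 * (n : ℝ) ^ (α / 2))⌋₊ := by
  obtain ⟨n₀, hn₀⟩ := Filter.eventually_atTop.1
    (ExpanderGraph.eventually_estimates hα0 hα1)
  refine ⟨n₀, fun n hn V _ _ hV G hG M hM hMn => ?_⟩
  classical
  obtain ⟨hn2, hx48, hlog, hg1, hαn⟩ := hn₀ n hn
  have hnR : (2 : ℝ) ≤ n := by exact_mod_cast hn2
  have hn0 : (0 : ℝ) < n := by linarith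
  have hlogn : 0 < Real.log n := Real.log_pos (by linarith)
  set x : ℝ := (n : ℝ) ^ (α / 4) with hx
  have hx0 : 0 < x := by linarith
  have hx2 : (n : ℝ) ^ (α / 2) = x ^ 2 := by
    rw [hx, ← Real.rpow_mul_natCast hn0.le]; congr 1; push_cast; ring
  have hx4 : (n : ℝ) ^ α = x ^ 4 := by
    rw [hx, ← Real.rpow_mul_natCast hn0.le]; congr 1; push_cast; ring
  rw [hx4] at hg1
  have hG' : ExpanderGraph.IsExpander G (x ^ 4) (4 * α * n / x ^ 4) (α * n / 3000) := by
    have h1 : 4 * (n : ℝ) * Real.log ((n : ℝ) ^ α) / ((n : ℝ) ^ α * Real.log n) =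
        4 * α * n / x ^ 4 := by
      rw [Real.log_rpow hn0, hx4]
      field_simp
    have h2 : (n : ℝ) * Real.log ((n : ℝ) ^ α) / (3000 * Real.log n) = α * n / 3000 := by
      rw [Real.log_rpow hn0]
      field_simp
    rw [ExpanderGraph.IsSExpander, hV, h1, h2, hx4] at hG
    exact hG
  set g : ℝ := 4 * α * n / x ^ 4 with hg
  have hsg : x ^ 4 * g / 2 = 2 * (α * n) := by
    rw [hg]; field_simp; ring
  have hM₀ : ∀ u v w, M.spanningCoe.Adj u v → M.spanningCoe.Adj u w → v = w := by
    intro u v w huv huw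
    rw [SimpleGraph.Subgraph.spanningCoe_adj] at huv huw
    exact (hM (M.edge_vert huv)).unique huv huw
  obtain ⟨he1, he2, he3, he4, he5⟩ := ExpanderGraph.deletion_estimates hx48 hlog
  obtain ⟨D, hDc, hDX⟩ := ExpanderGraph.exists_deletion (G := G) (p := 1 / x ^ 2)
    (r := x ^ 4 / 4) (τ := 3 * x) (g := g) hM₀ he1 he2
    (fun X hX => by have := hG'.1 X hX; linarith) he3 he4
    (by
      rw [hV, Real.log_mul (by norm_num) hn0.ne']
      have h4 : Real.log 4 ≤ 4 - 1 := Real.log_le_sub_one_of_pos (by norm_num)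
      linarith)
  have hMset : M.spanningCoe.edgeSet = M.edgeSet := rfl
  rw [hMset] at hDc
  set H := M.spanningCoe.deleteEdges (D : Set (Sym2 V)) with hH
  have hHM : H ≤ M.spanningCoe := SimpleGraph.deleteEdges_le _
  have hsupp : ((ExpanderGraph.covered H).card : ℝ) ≤ α * n / 4600 := by
    have h1 := ExpanderGraph.card_support_le hHM
    rw [hMset] at h1
    have h2 : ((ExpanderGraph.covered H).card : ℝ) ≤
      2 * M.edgeSet.ncard := by exact_mod_cast h1
    have h3 : α ^ 3 * n ≤ α * n := by
      refine mul_le_mul_of_nonneg_right ?_ hn0.le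
      calc α ^ 3 ≤ α ^ 1 := pow_le_pow_of_le_one hα0.le hα1 (by norm_num)
        _ = α := pow_one α
    linarith
  set lam : ℕ := 2 * ⌈α * n / 3000⌉₊ with hlam
  have hceil : (0 : ℝ) < α * n / 3000 := by positivity
  have hlam0 : 0 < lam := by have := Nat.ceil_pos.2 hceil; omega
  have hlamR : (lam : ℝ) ≤ α * n / 1500 + 2 := by
    have := Nat.ceil_lt_add_one hceil.le
    rw [hlam]; push_cast; linarith
  -- Chosen so that `T * α / 4 > 1`, hence `x ^ T > n`.
  set T : ℕ := ⌊4 / α⌋₊ + 1 with hT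
  have hT1 : 4 / α < T := by rw [hT]; push_cast; exact Nat.lt_floor_add_one _
  have hT2 : (T : ℝ) ≤ 4 / α + 1 := by
    rw [hT]; push_cast; linarith [Nat.floor_le (by positivity : 0 ≤ 4 / α)]
  have hxT : (Fintype.card V : ℝ) < x ^ T := by
    rw [hV, hx, ← Real.rpow_mul_natCast hn0.le]
    conv_lhs => rw [← Real.rpow_one (n : ℝ)]
    refine Real.rpow_lt_rpow_of_exponent_lt (by linarith) ?_
    rw [div_lt_iff₀ hα0] at hT1
    linarith
  obtain ⟨v, C, hC, hCH⟩ := ExpanderGraph.exists_isHamiltonianCycle_of_growth (G := G) (H := H)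
    (lam := lam) (T := T) (k := 4 * T + 8)
    (m := 21 * lam + 2 + (ExpanderGraph.covered H).card)
    (hHM.trans M.spanningCoe_le) (fun u v w huv huw => hM₀ u v w (hHM huv) (hHM huw)) hlam0
    (fun A B hA hB => hG'.2.exists_adj hA hB)
    (fun U hU hU' => hG'.exists_adj_notMem (by positivity) hg1
      (by rw [hsg]; linarith) hU hU')
    (ExpanderGraph.card_of_growth hG'.1 (by positivity) hg1 hDX hx0.le hxT
      (by rw [hsg]; linarith)) le_rfl le_rfl (by
        rw [hV]
        have h1 : (((4 * T + 8) * (21 * lam + 2 +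
            (ExpanderGraph.covered H).card) + lam : ℕ) : ℝ) ≤ n := by
          push_cast
          exact ExpanderGraph.size_estimate hα0 hα1 hαn hn0 (Nat.cast_nonneg _) (Nat.cast_nonneg _)
            hlamR hT2 hsupp
        exact_mod_cast h1)
  refine ⟨v, C, hC, Nat.le_floor ?_⟩
  -- The cycle contains all of `H`, so it can miss only deleted edges. Their number, at most
  -- `4|M|/x²`, is below the stated bound because `α ≤ 1`.
  have hsub : M.edgeSet \ {e | e ∈ C.edges} ⊆ (D : Set (Sym2 V)) := by
    rintro e ⟨heM, heC⟩
    by_contra heD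
    induction e with
    | h u w =>
      refine heC (hCH u w ?_)
      rw [hH, SimpleGraph.deleteEdges_adj]
      exact ⟨heM, heD⟩
  have h1 : ((M.edgeSet \ {e | e ∈ C.edges}).ncard : ℝ) ≤ D.card := by
    rw [← Set.ncard_coe_finset D]
    exact_mod_cast Set.ncard_le_ncard hsub (Finset.finite_toSet D)
  refine h1.trans (hDc.trans ?_)
  rw [hx2]
  have hα3 : α ^ 3 ≤ 1 := pow_le_one₀ hα0.le hα1
  rw [le_div_iff₀ (by positivity)]
  have : 4 * (1 / x ^ 2) * (M.edgeSet.ncard : ℝ) * (α ^ 3 * x ^ 2) =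
      4 * α ^ 3 * M.edgeSet.ncard := by field_simp
  rw [this]
  exact mul_le_mul_of_nonneg_right (by linarith) (Nat.cast_nonneg _)
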